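/- **Model.** A network is a finite undirected graph with integer capacities $R_{mk}=R_{km}\in\{0,1,2,\dots\}$ (packets per slot) on its links $\{m,k\}$, two source nodes $s_1,s_2$, a computation node $n$ of capacity $C_n\in\{0,1,2,\dots\}$ (processed packets per slot), and a destination $d$. In slot $t$, $A(t)$ queries arrive, where $A(0),A(1),\dots$ are i.i.d. with values in $\{0,1,2,\dots\}$, $\mathbb E[A(t)]=\lambda$ and $\mathbb E[A(t)^2]<\infty$. Each query gets its own tag and generates one raw packet with this tag at $s_1$ and one at $s_2$ (commodities $1$ and $2$, both to be delivered to $n$). Raw packets that have reached $n$ wait in the computation queues $\mathcal X_n^{(1)},\mathcal X_n^{(2)}$. A pair of raw packets with the same tag that are both at $n$ can be combined into one processed packet, which starts at $n$ and has to be delivered to $d$ (commodity $0$). The numbers of packets of commodity $c$ in the data queue at node $v$ and in $\mathcal X_n^{(i)}$ at the beginning of slot $t$ are $Q_v^{(c)}(t)$ and $X_n^{(i)}(t)$; packets that have reached their target leave the data queues, so that $Q_n^{(1)}=Q_n^{(2)}=Q_d^{(0)}=0$. Arrivals and moves of slot $t$ take effect at the beginning of slot $t+1$. If more service is allocated to a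 commodity at a node than it has packets there, all of them are sent, each over one link and within the service allocated there; otherwise as many are sent over each link as were allocated to it. **Maximum rate.** Let $\lambda^*$ be the supremum of the $x\le C_n$ for which $(x,x,x)$ is a feasible rate vector of the multicommodity flow problem with commodities $s_1\to n$, $s_2\to n$, $n\to d$, that is, for which there are $f^{(c)}_{mk}\ge 0$ for every commodity $c$ and every link in each direction, zero if $m$ is the target of $c$, with $\sum_c f^{(c)}_{mk}\le R_{mk}$ and $\sum_k f_{mk}^{(c)}-\sum_k f_{km}^{(c)}=x\,\mathbf 1\{m\text{ is the source of }c\}-x\,\mathbf 1\{m\text{ is the target of }c\}$ for all $m$ and $c$. **Non-overlapping networks.** There are node sets $V_1\ni s_1,s_2$ and $V_2\ni d$ with $V_1\cap V_2=\{n\}$ such that every link joins two nodes of $V_1$ or two nodes of $V_2$. Raw packets are routed over the links inside $V_1$, processed packets over the links inside $V_2$. **Policy $\pi_1$.** In every slot: 1. (Backpressure.) Each link $\{m,k\}$ selects, among the commodities carried by its part of the network, a commodity $c$ that maximizes $|Q_m^{(c)}(t)-Q_k^{(c)}(t)|$; it allocates its whole capacity $R_{mk}$ to $c$, from $m$ to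 $k$ if $Q_m^{(c)}(t)>Q_k^{(c)}(t)$ and from $k$ to $m$ if $Q_k^{(c)}(t)>Q_m^{(c)}(t)$, and allocates nothing else. 2. (Computation.) With $P_n(t)$ the number of tags of which both raw packets wait at $n$, exactly $\min\{P_n(t),C_n\}$ pairs with equal tags are combined. Ties, the packets to be sent and the pairs to be combined are chosen by any rule depending on the present and past states. **Theorem.** For non-overlapping networks, policy $\pi_1$, under any such rule, stabilizes the system for every query rate $\lambda<\lambda^*$: from every consistent initial state (such as the empty one), $$\limsup_{T\to\infty}\frac1T\sum_{t=1}^T\mathbb E\{Q_v^{(c)}(t)\}<\infty\ \text{ for all nodes }v\text{ and }c\in\{0,1,2\},\qquad \limsup_{T\to\infty}\frac1T\sum_{t=1}^T\mathbb E\{X_n^{(i)}(t)\}<\infty\ \text{ for }i\in\{1,2\}.$$ Here a deterministic state is consistent if raw packets are in $V_1$, processed packets in $V_2$, none is in a data queue at its own target, every packet is in one place only, the tags of the raw packets of the two sources are the same and differ from those of the processed packets, and no tag is one of a future query. -/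

import Mathlib

open MeasureTheory ProbabilityTheory Filter
open scoped ENNReal

/-- The three packet classes (commodities): `some i` are the raw packets generated at source `i`
(there are two sources, indexed by `Fin 2`), `none` are the processed packets. -/
abbrev Commodity : Type := Option (Fin 2)

/-- A network with one computation node and one query stream: an undirected graph with link
capacities (packets per slot), two sources, the computation node and its capacity (processed
packets per slot), and the destination. -/
structure Network (V : Type*) where
  graph : SimpleGraph V
  linkCap : Sym2 V → ℕ
  src : Fin 2 → V
  compNode : V
  compCap : ℕ
  dst : V

/-- Where packets of a class enter the data queues: raw packets at their source, processed packets
at the computation node. -/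
def Network.origin {V : Type*} (N : Network V) : Commodity → V
  | some i => N.src i
  | none => N.compNode

/-- Where packets of a class have to be delivered: raw packets to the computation node, processed
packets to the destination. -/
def Network.target {V : Type*} (N : Network V) : Commodity → V
  | some _ => N.compNode
  | none => N.dst

/-! ### Multicommodity flows and the query rate `λ*` -/

open Classical in
/-- The multicommodity flow feasibility region of a graph with link capacities, for commodities `c`
with source `src c` and destination `dst c`: the rate vectors for which there is a feasible flow,
`f c m k` being the flow of commodity `c` over the link from `m` to `k`. -/
def flowRegion {V C : Type*} [Fintype V] [Fintype C] (G : SimpleGraph V) (R : Sym2 V → ℕ)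
    (src dst : C → V) : Set (C → ℝ) :=
  {rate | ∃ f : C → V → V → ℝ,
    (∀ c m, (∑ k with G.Adj m k, f c m k) - (∑ k with G.Adj m k, f c k m) =
      (if m = src c then rate c else 0) - (if m = dst c then rate c else 0)) ∧
    (∀ m k, G.Adj m k → ∑ c, f c m k ≤ (R s(m, k) : ℝ)) ∧
    (∀ c m k, G.Adj m k → 0 ≤ f c m k) ∧
    (∀ c k, G.Adj (dst c) k → f c (dst c) k = 0)}

/-- The maximum query rate `λ*`: the supremum of the `x` for which `(x, x, x)` lies in the flow
region of the commodities (source 1 to computation node), (source 2 to computation node),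
(computation node to destination), and `x` is at most the computation capacity. -/
noncomputable def Network.maxQueryRate {V : Type*} [Fintype V] (N : Network V) : ℝ :=
  sSup {x : ℝ | (fun _ : Commodity => x) ∈ flowRegion N.graph N.linkCap N.origin N.target ∧
    x ≤ (N.compCap : ℝ)}

/-! ### Non-overlapping networks -/

/-- The network of raw data, with node set `V₁`, contains the sources and the computation node; the
network of processed data, with node set `V₂`, contains the computation node and the destination;
they share only the computation node, and every link belongs to one of the two. -/
structure Network.NonOverlapping {V : Type*} (N : Network V) (V₁ V₂ : Set V) : Prop where
  inter : V₁ ∩ V₂ = {N.compNode}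
  src_mem : ∀ i, N.src i ∈ V₁
  dst_mem : N.dst ∈ V₂
  edge : ∀ m k, N.graph.Adj m k → (m ∈ V₁ ∧ k ∈ V₁) ∨ (m ∈ V₂ ∧ k ∈ V₂)

/-- The node set of the network that carries a given class: raw packets are carried by `V₁`,
processed packets by `V₂`. -/
def carrier {V : Type*} (V₁ V₂ : Set V) : Commodity → Set V
  | some _ => V₁
  | none => V₂

/-! ### States, decisions and the queueing dynamics -/

/-- The state of the system at the beginning of a slot. Queries are tagged `0, 1, 2, …` in their
order of arrival. -/
structure QState (V : Type*) where
  /-- the number of queries so far, which is the tag of the next query -/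
  next : ℕ
  /-- the tags of the packets in the data queue of class `c` at node `v` -/
  queue : Commodity → V → Finset ℕ
  /-- the tags of the packets in the computation queue of source `i` at the computation node -/
  comp : Fin 2 → Finset ℕ

/-- The control decisions of one slot. -/
structure Decision (V : Type*) where
  /-- `alloc c m k` is the service (number of packets) allocated to class `c` from `m` to `k` -/
  alloc : Commodity → V → V → ℕ
  /-- the tags of the class `c` packets which are actually sent from `m` to `k` -/
  sent : Commodity → V → V → Finset ℕ
  /-- the tags of the pairs of raw packets that are combined at the computation node -/
  combine : Finset ℕ

/-- The length of the data queue of class `c` at node `v`. -/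
def QState.len {V : Type*} (S : QState V) (c : Commodity) (v : V) : ℕ := (S.queue c v).card

/-- The number of tags of which both raw packets wait at the computation node. -/
def QState.pairs {V : Type*} (S : QState V) : ℕ := (S.comp 0 ∩ S.comp 1).card

/-- The constraints on the decisions in state `S`. More service than there are packets waiting may
be allocated; the packets really sent are then all those in the queue. Two packets can be combined
only if they have the same tag and are both at the computation node. -/
structure Decision.Permissible {V : Type*} [Fintype V] (N : Network V) (S : QState V)
    (D : Decision V) : Prop where
  alloc_off : ∀ c m k, ¬ N.graph.Adj m k → D.alloc c m k = 0
  link : ∀ m k, N.graph.Adj m k → ∑ c, (D.alloc c m k + D.alloc c k m) ≤ N.linkCap s(m, k)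
  sent_subset : ∀ c m k, D.sent c m k ⊆ S.queue c m
  sent_disjoint : ∀ c m k l, k ≠ l → Disjoint (D.sent c m k) (D.sent c m l)
  sent_le : ∀ c m k, (D.sent c m k).card ≤ D.alloc c m k
  sent_total : ∀ c m, ∑ k, (D.sent c m k).card = min (S.len c m) (∑ k, D.alloc c m k)
  combine_subset : D.combine ⊆ S.comp 0 ∩ S.comp 1
  combine_le : D.combine.card ≤ N.compCap

/-- The differential backlog `|Q_m^{(c)} - Q_k^{(c)}|`. -/
def QState.diffBacklog {V : Type*} (S : QState V) (c : Commodity) (m k : V) : ℤ :=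
  |(S.len c m : ℤ) - (S.len c k : ℤ)|

/-- Backpressure routing and scheduling: every link `{m, k}` selects a class of maximal
differential backlog among the classes carried by its network (ties are broken arbitrarily), and
allocates its whole capacity to that class in the direction of the smaller queue. -/
def Decision.IsBackpressure {V : Type*} (N : Network V) (V₁ V₂ : Set V) (S : QState V)
    (D : Decision V) : Prop :=
  ∀ m k, N.graph.Adj m k → ∃ c : Commodity,
    (m ∈ carrier V₁ V₂ c ∧ k ∈ carrier V₁ V₂ c) ∧
    (∀ c', m ∈ carrier V₁ V₂ c' → k ∈ carrier V₁ V₂ c' →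
      S.diffBacklog c' m k ≤ S.diffBacklog c m k) ∧
    (∀ c', D.alloc c' m k = if c' = c ∧ S.len c k < S.len c m then N.linkCap s(m, k) else 0) ∧
    (∀ c', D.alloc c' k m = if c' = c ∧ S.len c m < S.len c k then N.linkCap s(m, k) else 0)

/-- The decisions that policy `π₁` can take in state `S`: backpressure routing, and combining as
many pairs with equal tags as the computation capacity admits. -/
structure Decision.IsPiOne {V : Type*} [Fintype V] (N : Network V) (V₁ V₂ : Set V)
    (S : QState V) (D : Decision V) : Prop where
  permissible : D.Permissible N S
  backpressure : D.IsBackpressure N V₁ V₂ S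
  combine_max : D.combine.card = min S.pairs N.compCap

/-- The state of the next slot, if the decision `D` is taken and `a` queries arrive during the
slot. Raw packets that reach the computation node enter its computation queues, processed packets
that reach the destination leave the system. -/
def QState.step {V : Type*} [Fintype V] [DecidableEq V] (N : Network V) (S : QState V)
    (D : Decision V) (a : ℕ) : QState V where
  next := S.next + a
  queue c v :=
    if v = N.target c then ∅ else
      (S.queue c v \ Finset.univ.biUnion (fun k => D.sent c v k)) ∪
        Finset.univ.biUnion (fun k => D.sent c k v) ∪
        (if v = N.origin c then
          (match c with
            | some _ => Finset.Ico S.next (S.next + a)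
            | none => D.combine)
        else ∅)
  comp i :=
    (S.comp i \ D.combine) ∪
      Finset.univ.biUnion (fun k => D.sent (some i) k N.compNode) ∪
      (if N.src i = N.compNode then Finset.Ico S.next (S.next + a) else ∅)

/-- The tags of all raw packets of source `i` in the system. -/
def QState.rawTags {V : Type*} [Fintype V] (S : QState V) (i : Fin 2) : Finset ℕ :=
  S.comp i ∪ Finset.univ.biUnion (fun v => S.queue (some i) v)

/-- The tags of all processed packets in the system. -/
def QState.procTags {V : Type*} [Fintype V] (S : QState V) : Finset ℕ :=
  Finset.univ.biUnion (fun v => S.queue none v)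

/-- The states in which the system may start (the empty state is one): no packet waits in a data
queue at its own target, each class is in its own network, every packet is in one place only, the
raw packets of the two sources have the same tags, different from those of the processed packets,
and no tag is one of a future query. -/
structure QState.Consistent {V : Type*} [Fintype V] (N : Network V) (V₁ V₂ : Set V)
    (S : QState V) : Prop where
  target_empty : ∀ c, S.queue c (N.target c) = ∅
  carried : ∀ c v, v ∉ carrier V₁ V₂ c → S.queue c v = ∅
  queue_disjoint : ∀ c v w, v ≠ w → Disjoint (S.queue c v) (S.queue c w)
  comp_disjoint : ∀ i v, Disjoint (S.comp i) (S.queue (some i) v)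
  paired : S.rawTags 0 = S.rawTags 1
  proc_disjoint : Disjoint (S.rawTags 0) S.procTags
  raw_lt : ∀ x ∈ S.rawTags 0, x < S.next
  proc_lt : ∀ x ∈ S.procTags, x < S.next

/-- A rule that takes the decision of a slot from the states of the previous slots (latest first)
and the present state. -/
abbrev Rule (V : Type*) : Type _ := List (QState V) → QState V → Decision V

/-- The past states and the state at slot `t`, under the rule `π`, from the initial state `S₀`, if
`a t` queries arrive during slot `t`. -/
def run {V : Type*} [Fintype V] [DecidableEq V] (N : Network V) (π : Rule V) (S₀ : QState V)
    (a : ℕ → ℕ) : ℕ → List (QState V) × QState V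
  | 0 => ([], S₀)
  | t + 1 =>
    ((run N π S₀ a t).2 :: (run N π S₀ a t).1,
      (run N π S₀ a t).2.step N (π (run N π S₀ a t).1 (run N π S₀ a t).2) (a t))

/-! ### Stability -/

/-- Strong stability of a queue with (random) length `q t` at slot `t`:
`limsup_{T → ∞} (1 / T) ∑_{t = 1}^T E[q t] < ∞`. -/
def StronglyStable {Ω : Type*} [MeasurableSpace Ω] (μ : Measure Ω) (q : ℕ → Ω → ℕ) : Prop :=
  limsup (fun T : ℕ => (∑ t ∈ Finset.Icc 1 T, ∫⁻ ω, (q t ω : ℝ≥0∞) ∂μ) / (T : ℝ≥0∞)) atTop < ⊤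

/-- The system is stable: all data queues and both computation queues are strongly stable. -/
def SystemStable {V Ω : Type*} [MeasurableSpace Ω] (μ : Measure Ω) (S : ℕ → Ω → QState V) : Prop :=
  (∀ c v, StronglyStable μ (fun t ω => (S t ω).len c v)) ∧
  (∀ i, StronglyStable μ (fun t ω => ((S t ω).comp i).card))

/-!
The proof is a quadratic Lyapunov argument in three coupled stages.

*Raw packets.* Backpressure allocates to the raw classes a service whose backlog-weighted sum is
`∑ R |ΔQ|` over the links inside `V₁`, with the larger of the two backlog differences. As both raw
classes have the same target, this dominates the total variation of the single potential
`ψ = max Q⁽¹⁾ Q⁽²⁾` (`Decision.IsBackpressure.variation_le`, `QState.Regular.variation_raw_le`). By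
weak duality between flows and potentials (`Network.flow_le_variation`), a feasible rate `x > λ`
shows that the variation exceeds the contribution of the arrivals. The surplus controls all
backlogs: along a path of positive capacities to the target, where the backlog is zero, the backlog
of a node is a sum of differences (`Network.exists_abs_sub_target_le`). The nodes without such a
path only ever hold packets of the initial state (`QState.Regular`). Using one potential for both
classes matters, since a flow may use the capacity of a link in both directions at the same time,
which a policy may not.

*Combination.* The number `W` of queries whose raw packets are in the system grows by the arrivals
and decreases by the combinations (`QState.Regular.queries_step`). Unless `Cₙ` pairs are combined,
`W` is at most `Cₙ` plus the raw packets in the data queues (`QState.Regular.queries_le`): of a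
query that cannot be combined, at least one packet is still on its way. Since `λ < x ≤ Cₙ`, the
drift of `W²` is negative up to a multiple of the raw backlog.

*Processed packets.* They are not generated by an independent sequence. But if `W` is added to the
backlog of processed packets at the computation node, then the combinations cancel and the sum
increases by the arrivals of queries; the drift of the corresponding quadratic function is negative
up to a multiple of `W` (`Network.NonOverlapping.exists_proc_drift`).

A weighted sum of the three functions has negative drift in the whole backlog
(`Network.NonOverlapping.exists_drift`). In this drift the arrivals enter through `(a - λ) G` with
`G` a function of the present state, which has mean zero by independence, and a telescoping sum
bounds the time averages (`limsup_average_run_lt_top`).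
-/

/-! ### Potentials, flows and reachability -/

/-- Pairing a potential `ψ` with the divergence of `g`, symmetrized over the two directions of each
link. -/
lemma two_mul_sum_mul_divergence {V : Type*} [Fintype V] (g : V → V → ℝ) (ψ : V → ℝ) :
    2 * ∑ m, ψ m * (∑ k, g m k - ∑ k, g k m) =
      ∑ m, ∑ k, (g m k - g k m) * (ψ m - ψ k) := by
  have h1 : ∑ m, ψ m * (∑ k, g m k - ∑ k, g k m) = ∑ m, ∑ k, (g m k - g k m) * ψ m := by
    refine Finset.sum_congr rfl fun m _ => ?_
    rw [← Finset.sum_sub_distrib, Finset.mul_sum]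
    exact Finset.sum_congr rfl fun k _ => mul_comm _ _
  have h2 : ∑ m, ψ m * (∑ k, g m k - ∑ k, g k m) = ∑ m, ∑ k, (g k m - g m k) * ψ k := by
    rw [h1, Finset.sum_comm]
  rw [two_mul]
  nth_rewrite 1 [h1]
  rw [h2, ← Finset.sum_add_distrib]
  refine Finset.sum_congr rfl fun m _ => ?_
  rw [← Finset.sum_add_distrib]
  exact Finset.sum_congr rfl fun k _ => by ring

open Classical in
/-- The capacity of the link `{m, k}`, extended by `0` to pairs of nodes that are not linked. -/
noncomputable def Network.cap {V : Type*} (N : Network V) (m k : V) : ℝ :=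
  if N.graph.Adj m k then (N.linkCap s(m, k) : ℝ) else 0

lemma Network.cap_nonneg {V : Type*} (N : Network V) (m k : V) : 0 ≤ N.cap m k := by
  unfold Network.cap; split_ifs <;> positivity

/-- The total variation of a potential along the links, weighted by the capacities. Each link is
counted in both directions. -/
noncomputable def Network.variation {V : Type*} [Fintype V] (N : Network V) (ψ : V → ℝ) : ℝ :=
  ∑ m, ∑ k, N.cap m k * |ψ m - ψ k|

lemma Network.variation_nonneg {V : Type*} [Fintype V] (N : Network V) (ψ : V → ℝ) :
    0 ≤ N.variation ψ :=
  Finset.sum_nonneg fun m _ => Finset.sum_nonneg fun k _ =>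
    mul_nonneg (N.cap_nonneg m k) (abs_nonneg _)

/-- Weak duality between flows and potentials, for classes with a common target: opposite flows of
such classes over a link cancel, so that the capacity, although it bounds each direction of a flow
separately, is charged only once. -/
lemma Network.flow_le_variation {V : Type*} [Fintype V] (N : Network V) {x : ℝ}
    (hx : (fun _ : Commodity => x) ∈ flowRegion N.graph N.linkCap N.origin N.target)
    (I : Finset Commodity) (t : V) (ht : ∀ c ∈ I, N.target c = t) (ψ : V → ℝ) :
    2 * (x * ∑ c ∈ I, (ψ (N.origin c) - ψ t)) ≤ N.variation ψ := by
  classical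
  obtain ⟨f, hcons, hcap, hpos, -⟩ := hx
  set g : V → V → ℝ := fun m k => if N.graph.Adj m k then ∑ c ∈ I, f c m k else 0 with hg
  have hg0 : ∀ m k, 0 ≤ g m k := fun m k => by
    simp only [hg]; split_ifs with h
    · exact Finset.sum_nonneg fun c _ => hpos c m k h
    · exact le_rfl
  have hgc : ∀ m k, g m k ≤ N.cap m k := fun m k => by
    simp only [hg, Network.cap]; split_ifs with h
    · exact (Finset.sum_le_sum_of_subset_of_nonneg (Finset.subset_univ I)
        fun c _ _ => hpos c m k h).trans (hcap m k h)
    · exact le_rfl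
  have hcapsymm : ∀ m k, N.cap m k = N.cap k m := fun m k => by
    simp only [Network.cap, N.graph.adj_comm m k, Sym2.eq_swap]
  have hdiv : ∀ m, ∑ k, g m k - ∑ k, g k m =
      ∑ c ∈ I, ((if m = N.origin c then x else 0) - (if m = t then x else 0)) := by
    intro m
    have e1 : ∑ k, g m k = ∑ c ∈ I, ∑ k with N.graph.Adj m k, f c m k := by
      rw [Finset.sum_comm, Finset.sum_filter]
    have e2 : ∑ k, g k m = ∑ c ∈ I, ∑ k with N.graph.Adj m k, f c k m := by
      rw [Finset.sum_comm, Finset.sum_filter]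
      exact Finset.sum_congr rfl fun k _ => by simp only [hg, N.graph.adj_comm k m]
    rw [e1, e2, ← Finset.sum_sub_distrib]
    refine Finset.sum_congr rfl fun c hc => ?_
    rw [hcons c m, ht c hc]
  have hsum : ∑ m, ψ m * (∑ k, g m k - ∑ k, g k m) = x * ∑ c ∈ I, (ψ (N.origin c) - ψ t) := by
    simp only [hdiv, Finset.mul_sum]
    rw [Finset.sum_comm]
    refine Finset.sum_congr rfl fun c _ => ?_
    simp [mul_sub, Finset.sum_sub_distrib, mul_comm]
  rw [← hsum, two_mul_sum_mul_divergence]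
  refine Finset.sum_le_sum fun m _ => Finset.sum_le_sum fun k _ => ?_
  have h1 : |g m k - g k m| ≤ N.cap m k :=
    abs_sub_le_of_nonneg_of_le (hg0 m k) (hgc m k) (hg0 k m) (hcapsymm m k ▸ hgc k m)
  calc _ ≤ |(g m k - g k m) * (ψ m - ψ k)| := le_abs_self _
    _ = |g m k - g k m| * |ψ m - ψ k| := abs_mul _ _
    _ ≤ _ := mul_le_mul_of_nonneg_right h1 (abs_nonneg _)

/-- Two nodes are joined by a link of positive capacity. -/
def Network.Linked {V : Type*} (N : Network V) (u v : V) : Prop :=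
  N.graph.Adj u v ∧ 0 < N.linkCap s(u, v)

/-- The nodes from which the target of class `c` is reached over links of positive capacity. -/
def Network.Reaches {V : Type*} (N : Network V) (c : Commodity) (v : V) : Prop :=
  Relation.ReflTransGen N.Linked v (N.target c)

lemma Network.Linked.abs_sub_le {V : Type*} [Fintype V] {N : Network V} {u v : V}
    (h : N.Linked u v) (ψ : V → ℝ) : |ψ u - ψ v| ≤ N.variation ψ := by
  have hc : 1 ≤ N.cap u v := by
    simp only [Network.cap, h.1, if_true]; exact_mod_cast h.2
  have h0 : ∀ m k, 0 ≤ N.cap m k * |ψ m - ψ k| := fun m k =>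
    mul_nonneg (N.cap_nonneg m k) (abs_nonneg _)
  calc |ψ u - ψ v| ≤ N.cap u v * |ψ u - ψ v| := le_mul_of_one_le_left (abs_nonneg _) hc
    _ ≤ ∑ k, N.cap u k * |ψ u - ψ k| :=
        Finset.single_le_sum (f := fun k => N.cap u k * |ψ u - ψ k|) (fun k _ => h0 u k)
          (Finset.mem_univ v)
    _ ≤ _ := Finset.single_le_sum (f := fun m => ∑ k, N.cap m k * |ψ m - ψ k|)
          (fun m _ => Finset.sum_nonneg fun k _ => h0 m k) (Finset.mem_univ u)

/-- The difference of a potential between the target and any node that reaches it is controlled by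
the variation, with one constant for all potentials. -/
lemma Network.exists_abs_sub_target_le {V : Type*} [Fintype V] (N : Network V) :
    ∃ L : ℝ, 0 ≤ L ∧ ∀ c v, N.Reaches c v → ∀ ψ : V → ℝ,
      |ψ v - ψ (N.target c)| ≤ L * N.variation ψ := by
  have key : ∀ c v, ∃ L : ℝ, 0 ≤ L ∧ (N.Reaches c v → ∀ ψ : V → ℝ,
      |ψ v - ψ (N.target c)| ≤ L * N.variation ψ) := by
    intro c v
    by_cases h : N.Reaches c v
    · suffices ∃ L : ℝ, 0 ≤ L ∧ ∀ ψ : V → ℝ, |ψ v - ψ (N.target c)| ≤ L * N.variation ψ by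
        obtain ⟨L, h0, hL⟩ := this
        exact ⟨L, h0, fun _ => hL⟩
      unfold Network.Reaches at h
      induction h using Relation.ReflTransGen.head_induction_on with
      | refl => exact ⟨0, le_rfl, fun ψ => by simp⟩
      | @head u w hl _ ih =>
        obtain ⟨L, h0, hL⟩ := ih
        refine ⟨1 + L, by linarith, fun ψ => (abs_sub_le _ (ψ w) _).trans ?_⟩
        have := hl.abs_sub_le ψ
        have := hL ψ
        linarith
    · exact ⟨0, le_rfl, fun h' => absurd h' h⟩
  choose L h0 hL using key
  refine ⟨∑ c, ∑ v, L c v, Finset.sum_nonneg fun c _ => Finset.sum_nonneg fun v _ => h0 c v,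
    fun c v h ψ => (hL c v h ψ).trans ?_⟩
  refine mul_le_mul_of_nonneg_right ?_ (N.variation_nonneg ψ)
  calc L c v ≤ ∑ v, L c v := Finset.single_le_sum (fun v _ => h0 c v) (Finset.mem_univ v)
    _ ≤ _ := Finset.single_le_sum (f := fun c => ∑ v, L c v)
      (fun c _ => Finset.sum_nonneg fun v _ => h0 c v) (Finset.mem_univ c)

/-- A positive feasible rate forces every origin to reach its target: otherwise the indicator of
the nodes that do not reach it is a potential of variation zero. -/
lemma Network.reaches_origin {V : Type*} [Fintype V] (N : Network V) {x : ℝ} (hx0 : 0 < x)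
    (hx : (fun _ : Commodity => x) ∈ flowRegion N.graph N.linkCap N.origin N.target)
    (c : Commodity) : N.Reaches c (N.origin c) := by
  classical
  by_contra hno
  set ψ : V → ℝ := fun v => if N.Reaches c v then 0 else 1 with hψ
  have h := N.flow_le_variation hx {c} (N.target c) (by simp) ψ
  have ht : ψ (N.target c) = 0 := by
    simp only [hψ]; exact if_pos Relation.ReflTransGen.refl
  have ho : ψ (N.origin c) = 1 := if_neg hno
  have hv : N.variation ψ = 0 := by
    refine Finset.sum_eq_zero fun m _ => Finset.sum_eq_zero fun k _ => ?_
    by_cases hl : N.Linked m k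
    · have hl' : N.Linked k m := ⟨hl.1.symm, by rw [Sym2.eq_swap]; exact hl.2⟩
      have : N.Reaches c m ↔ N.Reaches c k :=
        ⟨fun h => Relation.ReflTransGen.head hl' h, fun h => Relation.ReflTransGen.head hl h⟩
      simp [hψ, this]
    · have : N.cap m k = 0 := by
        unfold Network.cap
        split_ifs with ha
        · have : ¬ 0 < N.linkCap s(m, k) := fun h => hl ⟨ha, h⟩
          simpa using this
        · rfl
      simp [this]
  rw [Finset.sum_singleton, ht, ho, hv] at h
  linarith

lemma Network.NonOverlapping.compNode_mem {V : Type*} {N : Network V} {V₁ V₂ : Set V}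
    (hN : N.NonOverlapping V₁ V₂) : N.compNode ∈ V₁ ∧ N.compNode ∈ V₂ := by
  have : N.compNode ∈ V₁ ∩ V₂ := by rw [hN.inter]; rfl
  exact this

lemma Network.NonOverlapping.eq_compNode {V : Type*} {N : Network V} {V₁ V₂ : Set V}
    (hN : N.NonOverlapping V₁ V₂) {v : V} (h₁ : v ∈ V₁) (h₂ : v ∈ V₂) : v = N.compNode := by
  have : v ∈ V₁ ∩ V₂ := ⟨h₁, h₂⟩
  rwa [hN.inter] at this

lemma Network.NonOverlapping.origin_mem {V : Type*} {N : Network V} {V₁ V₂ : Set V}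
    (hN : N.NonOverlapping V₁ V₂) (c : Commodity) : N.origin c ∈ carrier V₁ V₂ c := by
  cases c with
  | none => exact hN.compNode_mem.2
  | some i => exact hN.src_mem i

/-! ### The service allocated by backpressure -/

/-- The service that backpressure allocates to the classes in `I`, weighted by the backlogs, is at
least half the variation of any potential whose differences are dominated, on every link, by those
of the backlog of the selected class (and vanish if that class is not in `I`). -/
lemma Decision.IsBackpressure.variation_le {V : Type*} [Fintype V] {N : Network V} {V₁ V₂ : Set V}
    {S : QState V} {D : Decision V} (hD : D.IsBackpressure N V₁ V₂ S)
    (hoff : ∀ c m k, ¬ N.graph.Adj m k → D.alloc c m k = 0)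
    (I : Finset Commodity) (ψ : V → ℝ)
    (h : ∀ m k c, m ∈ carrier V₁ V₂ c → k ∈ carrier V₁ V₂ c →
      (∀ c', m ∈ carrier V₁ V₂ c' → k ∈ carrier V₁ V₂ c' →
        S.diffBacklog c' m k ≤ S.diffBacklog c m k) →
      if c ∈ I then |ψ m - ψ k| ≤ |(S.len c m : ℝ) - S.len c k| else ψ m = ψ k) :
    N.variation ψ ≤ 2 * ∑ c ∈ I, ∑ v, (S.len c v : ℝ) *
      (∑ k, (D.alloc c v k : ℝ) - ∑ k, (D.alloc c k v : ℝ)) := by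
  classical
  rw [Finset.mul_sum]
  simp_rw [two_mul_sum_mul_divergence (fun m k => (D.alloc _ m k : ℝ)) (fun v => (S.len _ v : ℝ))]
  rw [Finset.sum_comm]
  refine Finset.sum_le_sum fun m _ => ?_
  rw [Finset.sum_comm]
  refine Finset.sum_le_sum fun k _ => ?_
  by_cases ha : N.graph.Adj m k
  · obtain ⟨c, ⟨hm, hk⟩, hmax, hmk, hkm⟩ := hD m k ha
    have hc := h m k c hm hk hmax
    have hterm : ∀ c' ∈ I, ((D.alloc c' m k : ℝ) - D.alloc c' k m) *
        ((S.len c' m : ℝ) - S.len c' k) =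
        if c' = c then N.cap m k * |(S.len c m : ℝ) - S.len c k| else 0 := by
      intro c' _
      rw [hmk c', hkm c', Network.cap, if_pos ha]
      by_cases hcc : c' = c
      · subst hcc
        rcases lt_trichotomy (S.len c' m) (S.len c' k) with hlt | heq | hgt
        · have : (S.len c' m : ℝ) < S.len c' k := by exact_mod_cast hlt
          rw [abs_of_neg (by linarith)]
          simp only [hlt, hlt.not_gt, and_false, and_true, if_true, if_false, Nat.cast_zero]
          ring
        · simp [heq]
        · have : (S.len c' k : ℝ) < S.len c' m := by exact_mod_cast hgt
          rw [abs_of_pos (by linarith)]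
          simp [hgt, hgt.not_gt]
      · simp [hcc]
    rw [Finset.sum_congr rfl hterm, Finset.sum_ite_eq']
    split_ifs at hc ⊢ with hcI
    · exact mul_le_mul_of_nonneg_left hc (N.cap_nonneg m k)
    · simp [hc]
  · have ha' : ¬ N.graph.Adj k m := fun h => ha h.symm
    have : N.cap m k = 0 := by simp [Network.cap, ha]
    simp [this, hoff _ m k ha, hoff _ k m ha']

/-- A bound on the service allocated to one class at one node. -/
def Network.totalCap {V : Type*} [Fintype V] (N : Network V) : ℕ :=
  ∑ m, ∑ k, N.linkCap s(m, k)

lemma Decision.Permissible.alloc_le {V : Type*} [Fintype V] {N : Network V} {S : QState V}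
    {D : Decision V} (hD : D.Permissible N S) (c : Commodity) (m k : V) :
    D.alloc c m k ≤ N.linkCap s(m, k) := by
  by_cases ha : N.graph.Adj m k
  · have h1 : D.alloc c m k + D.alloc c k m ≤ ∑ c, (D.alloc c m k + D.alloc c k m) :=
      Finset.single_le_sum (f := fun c => D.alloc c m k + D.alloc c k m)
        (fun _ _ => Nat.zero_le _) (Finset.mem_univ c)
    have := hD.link m k ha
    omega
  · simp [hD.alloc_off c m k ha]

lemma Decision.Permissible.sum_alloc_out_le {V : Type*} [Fintype V] {N : Network V} {S : QState V}
    {D : Decision V} (hD : D.Permissible N S) (c : Commodity) (v : V) :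
    ∑ k, D.alloc c v k ≤ N.totalCap :=
  (Finset.sum_le_sum fun k _ => hD.alloc_le c v k).trans
    (Finset.single_le_sum (f := fun m => ∑ k, N.linkCap s(m, k)) (fun _ _ => Nat.zero_le _)
      (Finset.mem_univ v))

lemma Decision.Permissible.sum_alloc_in_le {V : Type*} [Fintype V] {N : Network V} {S : QState V}
    {D : Decision V} (hD : D.Permissible N S) (c : Commodity) (v : V) :
    ∑ k, D.alloc c k v ≤ N.totalCap := by
  refine (Finset.sum_le_sum fun k _ => hD.alloc_le c k v).trans ?_
  simp_rw [Sym2.eq_swap (b := v)]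
  exact Finset.single_le_sum (f := fun m => ∑ k, N.linkCap s(m, k)) (fun _ _ => Nat.zero_le _)
      (Finset.mem_univ v)

/-! ### Invariants of the dynamics -/

/-- The packets of class `c` that are created in one slot. -/
def QState.fresh {V : Type*} (S : QState V) (D : Decision V) (a : ℕ) : Commodity → Finset ℕ
  | some _ => Finset.Ico S.next (S.next + a)
  | none => D.combine

lemma QState.mem_step_queue {V : Type*} [Fintype V] [DecidableEq V] (N : Network V) (S : QState V)
    (D : Decision V) (a : ℕ) (c : Commodity) (v : V) (x : ℕ) :
    x ∈ (S.step N D a).queue c v ↔ v ≠ N.target c ∧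
      ((x ∈ S.queue c v ∧ ∀ k, x ∉ D.sent c v k) ∨ (∃ k, x ∈ D.sent c k v) ∨
        (v = N.origin c ∧ x ∈ S.fresh D a c)) := by
  cases c <;> simp only [QState.step, QState.fresh] <;> split_ifs <;> simp_all

lemma QState.mem_step_comp {V : Type*} [Fintype V] [DecidableEq V] (N : Network V) (S : QState V)
    (D : Decision V) (a : ℕ) (i : Fin 2) (x : ℕ) :
    x ∈ (S.step N D a).comp i ↔
      (x ∈ S.comp i ∧ x ∉ D.combine) ∨ (∃ k, x ∈ D.sent (some i) k N.compNode) ∨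
        (N.src i = N.compNode ∧ x ∈ Finset.Ico S.next (S.next + a)) := by
  simp only [QState.step]; split_ifs <;> simp_all

lemma QState.mem_rawTags {V : Type*} [Fintype V] (S : QState V) (i : Fin 2) (x : ℕ) :
    x ∈ S.rawTags i ↔ x ∈ S.comp i ∨ ∃ v, x ∈ S.queue (some i) v := by
  simp [QState.rawTags]

/-- The part of consistency that the dynamics preserves and the drift estimates use. In addition,
the nodes from which the target of a class is not reached over links of positive capacity hold only
packets of that class from the finite set `F c`: such packets were there from the start. -/
structure QState.Regular {V : Type*} [Fintype V] (N : Network V) (V₁ V₂ : Set V)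
    (F : Commodity → Finset ℕ) (S : QState V) : Prop where
  target_empty : ∀ c, S.queue c (N.target c) = ∅
  carried : ∀ c v, v ∉ carrier V₁ V₂ c → S.queue c v = ∅
  raw_unique : ∀ i v w x, x ∈ S.queue (some i) v → x ∈ S.queue (some i) w → v = w
  comp_unique : ∀ i v x, x ∈ S.comp i → x ∉ S.queue (some i) v
  paired : S.rawTags 0 = S.rawTags 1
  raw_lt : ∀ i, ∀ x ∈ S.rawTags i, x < S.next
  confined : ∀ c v, ¬ N.Reaches c v → S.queue c v ⊆ F c

lemma QState.Consistent.regular {V : Type*} [Fintype V] {N : Network V} {V₁ V₂ : Set V}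
    {S : QState V} (h : S.Consistent N V₁ V₂) :
    S.Regular N V₁ V₂ (fun c => Finset.univ.biUnion (S.queue c)) where
  target_empty := h.target_empty
  carried := h.carried
  raw_unique i v w x hv hw := by
    by_contra hne
    exact Finset.disjoint_left.1 (h.queue_disjoint (some i) v w hne) hv hw
  comp_unique i v x hx := Finset.disjoint_left.1 (h.comp_disjoint i v) hx
  paired := h.paired
  raw_lt i x hx := by
    refine h.raw_lt x ?_
    fin_cases i
    · exact hx
    · rw [h.paired]; exact hx
  confined c v _ := Finset.subset_biUnion_of_mem (S.queue c) (Finset.mem_univ v)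

lemma Decision.Permissible.alloc_pos_of_mem {V : Type*} [Fintype V] {N : Network V} {S : QState V}
    {D : Decision V} (hD : D.Permissible N S) {c : Commodity} {m k : V} {x : ℕ}
    (hx : x ∈ D.sent c m k) : 0 < D.alloc c m k :=
  (Finset.card_pos.2 ⟨x, hx⟩).trans_le (hD.sent_le c m k)

lemma Decision.Permissible.linked_of_mem {V : Type*} [Fintype V] {N : Network V} {S : QState V}
    {D : Decision V} (hD : D.Permissible N S) {c : Commodity} {m k : V} {x : ℕ}
    (hx : x ∈ D.sent c m k) : N.Linked m k := by
  have h := hD.alloc_pos_of_mem hx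
  refine ⟨?_, h.trans_le (hD.alloc_le c m k)⟩
  by_contra ha
  rw [hD.alloc_off c m k ha] at h
  exact h.false

lemma Decision.IsPiOne.mem_carrier_of_mem {V : Type*} [Fintype V] {N : Network V} {V₁ V₂ : Set V}
    {S : QState V} {D : Decision V} (hD : D.IsPiOne N V₁ V₂ S) {c : Commodity} {m k : V} {x : ℕ}
    (hx : x ∈ D.sent c m k) : k ∈ carrier V₁ V₂ c := by
  have h := hD.permissible.alloc_pos_of_mem hx
  obtain ⟨c₀, ⟨-, hk⟩, -, hmk, -⟩ := hD.backpressure m k (hD.permissible.linked_of_mem hx).1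
  rw [hmk c] at h
  split_ifs at h with hc
  · exact hc.1 ▸ hk
  · exact absurd h (lt_irrefl _)

/-- A raw packet that is sent somewhere arrives there, either in the data queue or in the
computation queue; so the tags of the raw packets change only by arrivals and combinations. -/
lemma QState.Regular.rawTags_step {V : Type*} [Fintype V] [DecidableEq V] {N : Network V}
    {V₁ V₂ : Set V} {F : Commodity → Finset ℕ} {S : QState V} (hS : S.Regular N V₁ V₂ F)
    {D : Decision V} (hD : D.IsPiOne N V₁ V₂ S) (a : ℕ) (i : Fin 2) :
    (S.step N D a).rawTags i = (S.rawTags i \ D.combine) ∪ Finset.Ico S.next (S.next + a) := by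
  have hcomb : ∀ x ∈ D.combine, x ∈ S.comp i := fun x hx => by
    have := Finset.mem_inter.1 (hD.permissible.combine_subset hx)
    fin_cases i
    · exact this.1
    · exact this.2
  have hnot : ∀ v x, x ∈ S.queue (some i) v → x ∉ D.combine := fun v x hx hc =>
    hS.comp_unique i v x (hcomb x hc) hx
  have hsent : ∀ m k x, x ∈ D.sent (some i) m k → x ∈ S.queue (some i) m := fun m k x hx =>
    hD.permissible.sent_subset _ m k hx
  have ht : ∀ x, x ∉ S.queue (some i) N.compNode := fun x hx => by
    have := hS.target_empty (some i)
    simp only [Network.target] at this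
    simp [this] at hx
  ext x
  simp only [QState.mem_rawTags, QState.mem_step_queue, QState.mem_step_comp, Finset.mem_union,
    Finset.mem_sdiff, QState.fresh, Network.target, Network.origin]
  constructor
  · rintro ((⟨h, h'⟩ | ⟨k, hk⟩ | ⟨-, h⟩) | ⟨v, -, (⟨h, -⟩ | ⟨k, hk⟩ | ⟨-, h⟩)⟩)
    · exact Or.inl ⟨Or.inl h, h'⟩
    · exact Or.inl ⟨Or.inr ⟨k, hsent _ _ _ hk⟩, hnot k x (hsent _ _ _ hk)⟩
    · exact Or.inr h
    · exact Or.inl ⟨Or.inr ⟨v, h⟩, hnot v x h⟩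
    · exact Or.inl ⟨Or.inr ⟨k, hsent _ _ _ hk⟩, hnot k x (hsent _ _ _ hk)⟩
    · exact Or.inr h
  · rintro (⟨h | ⟨v, hv⟩, h'⟩ | h)
    · exact Or.inl (Or.inl ⟨h, h'⟩)
    · by_cases hs : ∃ k, x ∈ D.sent (some i) v k
      · obtain ⟨k, hk⟩ := hs
        by_cases hkn : k = N.compNode
        · exact Or.inl (Or.inr (Or.inl ⟨v, hkn ▸ hk⟩))
        · exact Or.inr ⟨k, hkn, Or.inr (Or.inl ⟨v, hk⟩)⟩
      · exact Or.inr ⟨v, fun hvn => ht x (hvn ▸ hv), Or.inl ⟨hv, fun k hk => hs ⟨k, hk⟩⟩⟩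
    · by_cases hs : N.src i = N.compNode
      · exact Or.inl (Or.inr (Or.inr ⟨hs, h⟩))
      · exact Or.inr ⟨N.src i, hs, Or.inr (Or.inr ⟨rfl, h⟩)⟩

lemma QState.Regular.step {V : Type*} [Fintype V] [DecidableEq V] {N : Network V}
    {V₁ V₂ : Set V} (hN : N.NonOverlapping V₁ V₂) (horig : ∀ c, N.Reaches c (N.origin c))
    {F : Commodity → Finset ℕ} {S : QState V} (hS : S.Regular N V₁ V₂ F)
    {D : Decision V} (hD : D.IsPiOne N V₁ V₂ S) (a : ℕ) :
    (S.step N D a).Regular N V₁ V₂ F := by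
  have hsent : ∀ c m k x, x ∈ D.sent c m k → x ∈ S.queue c m := fun c m k x hx =>
    hD.permissible.sent_subset _ m k hx
  have hold : ∀ i v x, x ∈ S.queue (some i) v → x ∉ Finset.Ico S.next (S.next + a) := by
    intro i v x hx hI
    have := hS.raw_lt i x ((S.mem_rawTags i x).2 (Or.inr ⟨v, hx⟩))
    rw [Finset.mem_Ico] at hI
    omega
  have hold' : ∀ i x, x ∈ S.comp i → x ∉ Finset.Ico S.next (S.next + a) := by
    intro i x hx hI
    have := hS.raw_lt i x ((S.mem_rawTags i x).2 (Or.inl hx))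
    rw [Finset.mem_Ico] at hI
    omega
  -- The packet `x` cannot leave along two different links.
  have hdest : ∀ i m m' k l x, x ∈ D.sent (some i) m k → x ∈ D.sent (some i) m' l → k = l := by
    intro i m m' k l x hk hl
    have hm := hS.raw_unique i m m' x (hsent _ _ _ _ hk) (hsent _ _ _ _ hl)
    subst hm
    by_contra hne
    exact Finset.disjoint_left.1 (hD.permissible.sent_disjoint _ m k l hne) hk hl
  -- A packet that stays in its queue is not sent from anywhere.
  have hstay : ∀ i v m k x, x ∈ S.queue (some i) v → (∀ k, x ∉ D.sent (some i) v k) →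
      x ∉ D.sent (some i) m k := by
    intro i v m k x hx hns hk
    have hm := hS.raw_unique i m v x (hsent _ _ _ _ hk) hx
    exact hns k (hm ▸ hk)
  refine ⟨fun c => ?_, fun c v hv => ?_, fun i v w x hv hw => ?_, fun i v x hx hv => ?_, ?_,
    fun i x hx => ?_, fun c v hv x hx => ?_⟩
  · simp [QState.step]
  · refine Finset.eq_empty_of_forall_notMem fun x hx => ?_
    obtain ⟨-, ⟨h, -⟩ | ⟨k, hk⟩ | ⟨h, -⟩⟩ := (S.mem_step_queue N D a c v x).1 hx
    · simp [hS.carried c v hv] at h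
    · exact hv (hD.mem_carrier_of_mem hk)
    · exact hv (h ▸ hN.origin_mem c)
  · rw [QState.mem_step_queue] at hv hw
    obtain ⟨-, ⟨h, hn⟩ | ⟨k, hk⟩ | ⟨h, hf⟩⟩ := hv <;>
    obtain ⟨-, ⟨h', hn'⟩ | ⟨k', hk'⟩ | ⟨h', hf'⟩⟩ := hw
    · exact hS.raw_unique i v w x h h'
    · exact absurd hk' (hstay i v _ _ x h hn)
    · exact absurd hf' (hold i v x h)
    · exact absurd hk (hstay i w _ _ x h' hn')
    · exact hdest i k k' v w x hk hk'
    · exact absurd hf' (hold i k x (hsent _ _ _ _ hk))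
    · exact absurd hf (hold i w x h')
    · exact absurd hf (hold i k' x (hsent _ _ _ _ hk'))
    · exact h.trans h'.symm
  · rw [QState.mem_step_queue] at hv
    rw [QState.mem_step_comp] at hx
    obtain ⟨hvt, hv⟩ := hv
    obtain ⟨h, hn⟩ | ⟨k, hk⟩ | ⟨h, hf⟩ := hv <;>
    obtain ⟨h', hn'⟩ | ⟨k', hk'⟩ | ⟨h', hf'⟩ := hx
    · exact hS.comp_unique i v x h' h
    · exact hstay i v _ _ x h hn hk'
    · exact hold i v x h hf'
    · exact hS.comp_unique i k x h' (hsent _ _ _ _ hk)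
    · exact hvt (hdest i k k' v _ x hk hk')
    · exact hold i k x (hsent _ _ _ _ hk) hf'
    · exact hold' i x h' hf
    · exact hold i k' x (hsent _ _ _ _ hk') hf
    · exact hvt (h.trans h')
  · rw [hS.rawTags_step hD, hS.rawTags_step hD, hS.paired]
  · rw [hS.rawTags_step hD, Finset.mem_union, Finset.mem_sdiff, Finset.mem_Ico] at hx
    have h1 : (S.step N D a).next = S.next + a := rfl
    rcases hx with ⟨h, -⟩ | h
    · have := hS.raw_lt i x h
      omega
    · omega
  · obtain ⟨-, ⟨h, -⟩ | ⟨k, hk⟩ | ⟨h, -⟩⟩ := (S.mem_step_queue N D a c v x).1 hx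
    · exact hS.confined c v hv h
    · have hkv := hD.permissible.linked_of_mem hk
      have hvk : N.Linked v k := ⟨hkv.1.symm, by rw [Sym2.eq_swap]; exact hkv.2⟩
      exact hS.confined c k (fun h => hv (Relation.ReflTransGen.head hvk h)) (hsent _ _ _ _ hk)
    · exact absurd (h ▸ horig c) hv

lemma QState.Consistent.regular_run {V : Type*} [Fintype V] [DecidableEq V] {N : Network V}
    {V₁ V₂ : Set V} (hN : N.NonOverlapping V₁ V₂) (horig : ∀ c, N.Reaches c (N.origin c))
    {π : Rule V} (hπ : ∀ h S, (π h S).IsPiOne N V₁ V₂ S)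
    {S₀ : QState V} (hS₀ : S₀.Consistent N V₁ V₂) (a : ℕ → ℕ) (t : ℕ) :
    (run N π S₀ a t).2.Regular N V₁ V₂ (fun c => Finset.univ.biUnion (S₀.queue c)) := by
  induction t with
  | zero => exact hS₀.regular
  | succ t ih => exact ih.step hN horig (hπ _ _) _

/-! ### Queue lengths after one slot -/

lemma QState.len_step_le {V : Type*} [Fintype V] [DecidableEq V] {N : Network V} {S : QState V}
    {D : Decision V} (hD : D.Permissible N S) (a : ℕ) (c : Commodity) (v : V) :
    (S.step N D a).len c v ≤ (S.len c v - ∑ k, D.alloc c v k) + ∑ k, D.alloc c k v +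
      (if v = N.origin c then (S.fresh D a c).card else 0) := by
  have hsub : (S.step N D a).queue c v ⊆
      (S.queue c v \ Finset.univ.biUnion (fun k => D.sent c v k)) ∪
        Finset.univ.biUnion (fun k => D.sent c k v) ∪
        (if v = N.origin c then S.fresh D a c else ∅) := by
    intro x hx
    obtain ⟨-, h⟩ := (S.mem_step_queue N D a c v x).1 hx
    split_ifs <;> simp_all
  have hout : (Finset.univ.biUnion (fun k => D.sent c v k)).card =
      min (S.len c v) (∑ k, D.alloc c v k) := by
    rw [Finset.card_biUnion fun k _ l _ h => hD.sent_disjoint c v k l h, hD.sent_total]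
  have h1 : (S.queue c v \ Finset.univ.biUnion (fun k => D.sent c v k)).card =
      S.len c v - ∑ k, D.alloc c v k := by
    rw [Finset.card_sdiff_of_subset (Finset.biUnion_subset.2 fun k _ => hD.sent_subset c v k), hout]
    change S.len c v - _ = _
    omega
  have h2 : (Finset.univ.biUnion (fun k => D.sent c k v)).card ≤ ∑ k, D.alloc c k v :=
    Finset.card_biUnion_le.trans (Finset.sum_le_sum fun k _ => hD.sent_le c k v)
  have h3 : (if v = N.origin c then S.fresh D a c else ∅).card =
      if v = N.origin c then (S.fresh D a c).card else 0 := by split_ifs <;> simp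
  calc (S.step N D a).len c v ≤ _ := Finset.card_le_card hsub
    _ ≤ _ := (Finset.card_union_le _ _).trans
      (Nat.add_le_add_right (Finset.card_union_le _ _) _)
    _ ≤ _ := by rw [h1, h3]; omega

/-- The number of queries whose raw packets are still in the system. -/
def QState.queries {V : Type*} [Fintype V] (S : QState V) : ℕ := (S.rawTags 0).card

lemma QState.Regular.card_rawTags {V : Type*} [Fintype V] {N : Network V}
    {V₁ V₂ : Set V} {F : Commodity → Finset ℕ} {S : QState V} (hS : S.Regular N V₁ V₂ F)
    (i : Fin 2) : (S.rawTags i).card = S.queries := by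
  fin_cases i
  · rfl
  · exact congrArg Finset.card hS.paired.symm

lemma QState.Regular.comp_card_le {V : Type*} [Fintype V] {N : Network V}
    {V₁ V₂ : Set V} {F : Commodity → Finset ℕ} {S : QState V} (hS : S.Regular N V₁ V₂ F)
    (i : Fin 2) : (S.comp i).card ≤ S.queries := by
  rw [← hS.card_rawTags i]
  exact Finset.card_le_card Finset.subset_union_left

lemma QState.pairs_le_queries {V : Type*} [Fintype V] (S : QState V) : S.pairs ≤ S.queries :=
  Finset.card_le_card (Finset.inter_subset_left.trans Finset.subset_union_left)

lemma QState.Regular.queries_step {V : Type*} [Fintype V] [DecidableEq V] {N : Network V}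
    {V₁ V₂ : Set V} {F : Commodity → Finset ℕ} {S : QState V} (hS : S.Regular N V₁ V₂ F)
    {D : Decision V} (hD : D.IsPiOne N V₁ V₂ S) (a : ℕ) :
    (S.step N D a).queries + D.combine.card ≤ S.queries + a := by
  have hsub : D.combine ⊆ S.rawTags 0 := hD.permissible.combine_subset.trans
    (Finset.inter_subset_left.trans Finset.subset_union_left)
  have h1 := Finset.card_sdiff_add_card_eq_card hsub
  have h2 := Finset.card_union_le (S.rawTags 0 \ D.combine) (Finset.Ico S.next (S.next + a))
  rw [Nat.card_Ico] at h2
  have h3 : (S.step N D a).queries = _ := congrArg Finset.card (hS.rawTags_step hD a 0)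
  rw [h3]
  simp only [QState.queries] at *
  omega

/-- A query that is not ready to be combined still has a raw packet in a data queue: if one of its
raw packets has reached the computation node, the other one is on its way. -/
lemma QState.Regular.queries_le {V : Type*} [Fintype V] {N : Network V}
    {V₁ V₂ : Set V} {F : Commodity → Finset ℕ} {S : QState V} (hS : S.Regular N V₁ V₂ F) :
    S.queries ≤ S.pairs + ∑ i : Fin 2, ∑ v, S.len (some i) v := by
  classical
  have hsub : S.rawTags 0 ⊆ (S.comp 0 ∩ S.comp 1) ∪
      Finset.univ.biUnion fun i : Fin 2 => Finset.univ.biUnion fun v => S.queue (some i) v := by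
    intro x hx
    have hx1 : x ∈ S.rawTags 1 := hS.paired ▸ hx
    rw [QState.mem_rawTags] at hx hx1
    simp only [Finset.mem_union, Finset.mem_inter, Finset.mem_biUnion, Finset.mem_univ, true_and,
      Fin.exists_fin_two]
    tauto
  refine (Finset.card_le_card hsub).trans ((Finset.card_union_le _ _).trans ?_)
  refine Nat.add_le_add_left (Finset.card_biUnion_le.trans ?_) _
  exact Finset.sum_le_sum fun i _ => Finset.card_biUnion_le

/-! ### Drift estimates -/

/-- The squared length of a queue after one slot, with `w` a component that is not served. -/
lemma sq_queue_step_le {q q' w w' μ z : ℕ} (h : q' + w' ≤ (q - μ) + w + z) :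
    ((q' : ℝ) + w') ^ 2 ≤
      ((q : ℝ) + w) ^ 2 + 2 * q * (z - μ) + 2 * w * z + (μ : ℝ) ^ 2 + (z : ℝ) ^ 2 := by
  have h1 : (q' : ℝ) + w' ≤ ((q - μ : ℕ) : ℝ) + w + z := by exact_mod_cast h
  have h2 : ((q' : ℝ) + w') ^ 2 ≤ (((q - μ : ℕ) : ℝ) + w + z) ^ 2 :=
    pow_le_pow_left₀ (by positivity) h1 2
  refine h2.trans ?_
  have hw : (0 : ℝ) ≤ w := by positivity
  have hz : (0 : ℝ) ≤ z := by positivity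
  have hq : (0 : ℝ) ≤ q := by positivity
  have hμ : (0 : ℝ) ≤ μ := by positivity
  rcases le_total μ q with hle | hle
  · rw [Nat.cast_sub hle]
    nlinarith [mul_nonneg hw hμ, mul_nonneg hz hμ]
  · rw [Nat.sub_eq_zero_of_le hle]
    have : (q : ℝ) ≤ μ := by exact_mod_cast hle
    push_cast
    nlinarith [mul_nonneg hw hq, mul_nonneg hz hq, sq_nonneg ((q : ℝ) - μ)]

/-- If the arrival rate `lam` is below the rate `x` that the variation `w` supports, then the
variation that the arrivals leave over controls the total backlog `T`. -/
lemma exists_negative_drift {lam x B M : ℝ} (h0 : 0 ≤ lam) (hx : lam < x) (hB : 0 ≤ B)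
    (hM : 0 ≤ M) : ∃ η : ℝ, 0 < η ∧ ∃ K : ℝ, 0 ≤ K ∧ ∀ w G T : ℝ, 0 ≤ w →
      2 * (x * G) ≤ w → T ≤ B * w + M → 2 * lam * G + η * T ≤ w + K := by
  have hx0 : 0 < x := h0.trans_lt hx
  set δ := 1 - lam / x with hδ
  have hδ0 : 0 < δ := by rw [hδ, sub_pos, div_lt_one hx0]; exact hx
  have hB1 : 0 < B + 1 := by linarith
  refine ⟨δ / (B + 1), by positivity, δ / (B + 1) * M, by positivity, fun w G T hw hG hT => ?_⟩
  have h1 : 2 * lam * G ≤ lam / x * w := by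
    calc 2 * lam * G = lam / x * (2 * (x * G)) := by field_simp
      _ ≤ _ := mul_le_mul_of_nonneg_left hG (by positivity)
  have h2 : δ / (B + 1) * T ≤ δ / (B + 1) * (B * w + M) :=
    mul_le_mul_of_nonneg_left hT (by positivity)
  have h3 : δ / (B + 1) * (B * w) ≤ δ * w := by
    rw [div_mul_eq_mul_div, div_le_iff₀ hB1]
    nlinarith [mul_nonneg hδ0.le hw]
  have h4 : δ * w = w - lam / x * w := by rw [hδ]; ring
  linarith [mul_add (δ / (B + 1)) (B * w) M]

/-- The quadratic Lyapunov function of the raw packets in the data queues. -/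
noncomputable def QState.rawLyapunov {V : Type*} [Fintype V] (S : QState V) : ℝ :=
  ∑ i : Fin 2, ∑ v, (S.len (some i) v : ℝ) ^ 2

/-- The quadratic Lyapunov function of the processed packets, in which the queries that still wait
for their processed packet are counted at the computation node. In this way the combinations cancel,
and the queries enter at the rate of the arrivals. -/
noncomputable def QState.procLyapunov {V : Type*} [Fintype V] [DecidableEq V] (N : Network V)
    (S : QState V) : ℝ :=
  ∑ v, ((S.len none v : ℝ) + (if v = N.compNode then S.queries else 0 : ℕ)) ^ 2

/-- Since both raw classes have the same target, the pointwise maximum of their backlogs serves as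
one potential: its variation is dominated by the service allocated by backpressure. -/
lemma QState.Regular.variation_raw_le {V : Type*} [Fintype V] {N : Network V}
    {V₁ V₂ : Set V} (hN : N.NonOverlapping V₁ V₂) {F : Commodity → Finset ℕ} {S : QState V}
    (hS : S.Regular N V₁ V₂ F) {D : Decision V} (hD : D.IsPiOne N V₁ V₂ S) :
    N.variation (fun v => max (S.len (some 0) v : ℝ) (S.len (some 1) v)) ≤
      2 * ∑ i : Fin 2, ∑ v, (S.len (some i) v : ℝ) *
        (∑ k, (D.alloc (some i) v k : ℝ) - ∑ k, (D.alloc (some i) k v : ℝ)) := by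
  have hmain := hD.backpressure.variation_le hD.permissible.alloc_off
    (Finset.univ.map Function.Embedding.some)
    (fun v => max (S.len (some 0) v : ℝ) (S.len (some 1) v)) ?_
  · rwa [Finset.sum_map] at hmain
  intro m k c hm hk hmax
  have hzero : ∀ i, ∀ v ∈ V₂, S.len (some i) v = 0 := by
    intro i v hv
    rw [QState.len, Finset.card_eq_zero]
    by_cases hv1 : v ∈ V₁
    · rw [hN.eq_compNode hv1 hv]
      exact hS.target_empty (some i)
    · exact hS.carried (some i) v hv1
  cases c with
  | none =>
    rw [if_neg (by simp)]
    simp only [carrier] at hm hk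
    simp [hzero _ m hm, hzero _ k hk]
  | some i =>
    rw [if_pos (by simp)]
    have hdiff : ∀ j : Fin 2, |(S.len (some j) m : ℝ) - S.len (some j) k| ≤
        |(S.len (some i) m : ℝ) - S.len (some i) k| := fun j => by
      have := hmax (some j) hm hk
      simp only [QState.diffBacklog] at this
      exact_mod_cast this
    exact (abs_max_sub_max_le_max _ _ _ _).trans (max_le (hdiff 0) (hdiff 1))

/-- The backlog of the processed packets, extended from `V₂` by its value at the computation node,
is a potential whose variation is dominated by the service allocated by backpressure. -/
lemma Decision.IsPiOne.variation_proc_le {V : Type*} [Fintype V] {N : Network V}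
    {V₁ V₂ : Set V} [DecidablePred (· ∈ V₂)] (hN : N.NonOverlapping V₁ V₂) {S : QState V}
    {D : Decision V} (hD : D.IsPiOne N V₁ V₂ S) :
    N.variation (fun v => if v ∈ V₂ then (S.len none v : ℝ) else S.len none N.compNode) ≤
      2 * ∑ v, (S.len none v : ℝ) *
        (∑ k, (D.alloc none v k : ℝ) - ∑ k, (D.alloc none k v : ℝ)) := by
  have hmain := hD.backpressure.variation_le hD.permissible.alloc_off {none}
    (fun v => if v ∈ V₂ then (S.len none v : ℝ) else S.len none N.compNode) ?_
  · rwa [Finset.sum_singleton] at hmain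
  intro m k c hm hk _
  cases c with
  | none =>
    rw [if_pos (by simp)]
    simp only [carrier] at hm hk
    simp [hm, hk]
  | some i =>
    rw [if_neg (by simp)]
    have hconst : ∀ v ∈ V₁, (if v ∈ V₂ then (S.len none v : ℝ) else S.len none N.compNode) =
        S.len none N.compNode := by
      intro v hv
      split_ifs with h
      · rw [hN.eq_compNode hv h]
      · rfl
    exact (hconst m hm).trans (hconst k hk).symm

/-- Drift of the raw packets. The last term has mean zero if `a` has mean `lam`. -/
lemma Network.NonOverlapping.exists_raw_drift {V : Type*} [Fintype V] [DecidableEq V]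
    {N : Network V} {V₁ V₂ : Set V} (hN : N.NonOverlapping V₁ V₂) (F : Commodity → Finset ℕ)
    {lam x : ℝ} (h0 : 0 ≤ lam) (hlx : lam < x)
    (hx : (fun _ : Commodity => x) ∈ flowRegion N.graph N.linkCap N.origin N.target) :
    ∃ η : ℝ, 0 < η ∧ ∃ K : ℝ, 0 ≤ K ∧ ∀ S : QState V, S.Regular N V₁ V₂ F →
      ∀ D : Decision V, D.IsPiOne N V₁ V₂ S → ∀ a : ℕ,
      (S.step N D a).rawLyapunov + η * ∑ i : Fin 2, ∑ v, (S.len (some i) v : ℝ) ≤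
        S.rawLyapunov + K * (1 + (a : ℝ) ^ 2) +
          2 * (a - lam) * ∑ i : Fin 2, (S.len (some i) (N.src i) : ℝ) := by
  obtain ⟨L, hL0, hL⟩ := N.exists_abs_sub_target_le
  obtain ⟨η, hη, K, hK, hdrift⟩ := exists_negative_drift
    (B := ∑ _i : Fin 2, ∑ _v : V, L) (M := ∑ i : Fin 2, ∑ _v : V, ((F (some i)).card : ℝ))
    h0 hlx (by positivity) (by positivity)
  set r : ℝ := (N.totalCap : ℝ) with hr
  have hr0 : 0 ≤ r := Nat.cast_nonneg _
  set K₁ : ℝ := ∑ _i : Fin 2, ∑ _v : V, (3 * r ^ 2 + 2) with hK₁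
  refine ⟨η, hη, K₁ + K, by positivity, fun S hS D hD a => ?_⟩
  set ψ : V → ℝ := fun v => max (S.len (some 0) v : ℝ) (S.len (some 1) v) with hψ
  have hle : ∀ (i : Fin 2) v, (S.len (some i) v : ℝ) ≤ ψ v := by
    intro i v
    fin_cases i
    · exact le_max_left _ _
    · exact le_max_right _ _
  have hψ0 : ψ N.compNode = 0 := by
    have : ∀ i : Fin 2, S.len (some i) N.compNode = 0 := fun i =>
      Finset.card_eq_zero.2 (hS.target_empty (some i))
    simp [hψ, this]
  have hvar := hS.variation_raw_le hN hD
  have hflow : 2 * (x * ∑ i : Fin 2, (S.len (some i) (N.src i) : ℝ)) ≤ N.variation ψ := by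
    have := N.flow_le_variation hx (Finset.univ.map Function.Embedding.some) N.compNode
      (by rintro (_ | i) h <;> simp_all [Network.target]) ψ
    rw [Finset.sum_map, hψ0] at this
    refine le_trans ?_ this
    have hx0 : 0 ≤ x := h0.trans hlx.le
    gcongr with i
    simpa [Network.origin] using hle i (N.src i)
  have hback : ∑ i : Fin 2, ∑ v, (S.len (some i) v : ℝ) ≤
      (∑ _i : Fin 2, ∑ _v : V, L) * N.variation ψ +
        ∑ i : Fin 2, ∑ _v : V, ((F (some i)).card : ℝ) := by
    simp_rw [Finset.sum_mul]
    rw [← Finset.sum_add_distrib]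
    refine Finset.sum_le_sum fun i _ => ?_
    rw [← Finset.sum_add_distrib]
    refine Finset.sum_le_sum fun v _ => ?_
    by_cases hv : N.Reaches (some i) v
    · have h1 := (le_abs_self _).trans (hL (some i) v hv ψ)
      simp only [Network.target, hψ0, sub_zero] at h1
      have h2 : (0 : ℝ) ≤ (F (some i)).card := by positivity
      linarith [hle i v]
    · have h1 : (S.len (some i) v : ℝ) ≤ (F (some i)).card := by
        exact_mod_cast Finset.card_le_card (hS.confined (some i) v hv)
      have h2 := mul_nonneg hL0 (N.variation_nonneg ψ)
      linarith
  have hd := hdrift _ _ _ (N.variation_nonneg ψ) hflow hback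
  set e : ℝ := (3 * r ^ 2 + 2) * (1 + (a : ℝ) ^ 2) with he
  have hsq : ∀ (i : Fin 2) v, ((S.step N D a).len (some i) v : ℝ) ^ 2 ≤
      (S.len (some i) v : ℝ) ^ 2 - 2 * ((S.len (some i) v : ℝ) *
        (∑ k, (D.alloc (some i) v k : ℝ) - ∑ k, (D.alloc (some i) k v : ℝ))) +
        2 * a * (if v = N.src i then (S.len (some i) v : ℝ) else 0) +
        e := by
    intro i v
    have hlen : (S.step N D a).len (some i) v ≤ (S.len (some i) v - ∑ k, D.alloc (some i) v k) +
        ∑ k, D.alloc (some i) k v + (if v = N.src i then a else 0) := by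
      have h := QState.len_step_le hD.permissible a (some i) v
      rwa [show (S.fresh D a (some i)).card = a by simp [QState.fresh]] at h
    have hout : ((∑ k, D.alloc (some i) v k : ℕ) : ℝ) ≤ r :=
      Nat.cast_le.2 (hD.permissible.sum_alloc_out_le (some i) v)
    have hin : ((∑ k, D.alloc (some i) k v : ℕ) : ℝ) ≤ r :=
      Nat.cast_le.2 (hD.permissible.sum_alloc_in_le (some i) v)
    have h1 := sq_queue_step_le (q := S.len (some i) v) (q' := (S.step N D a).len (some i) v)
      (w := 0) (w' := 0) (μ := ∑ k, D.alloc (some i) v k)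
      (z := ∑ k, D.alloc (some i) k v + (if v = N.src i then a else 0))
      (by simpa [add_assoc] using hlen)
    have ha : (0 : ℝ) ≤ a := by positivity
    set μ : ℝ := ((∑ k, D.alloc (some i) v k : ℕ) : ℝ) with hμ
    set ν : ℝ := ((∑ k, D.alloc (some i) k v : ℕ) : ℝ) with hν
    have hμ0 : 0 ≤ μ := Nat.cast_nonneg _
    have hν0 : 0 ≤ ν := Nat.cast_nonneg _
    have hμ2 : μ ^ 2 ≤ r ^ 2 := pow_le_pow_left₀ hμ0 hout 2
    have hν2 : ν ^ 2 ≤ r ^ 2 := pow_le_pow_left₀ hν0 hin 2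
    have hμe : μ = ∑ k, (D.alloc (some i) v k : ℝ) := by simp [hμ]
    have hνe : ν = ∑ k, (D.alloc (some i) k v : ℝ) := by simp [hν]
    rw [← hμe, ← hνe, he]
    have hra : (0 : ℝ) ≤ r ^ 2 * (a : ℝ) ^ 2 := by positivity
    rw [Nat.cast_add, ← hν] at h1
    split_ifs at h1 ⊢ <;> push_cast at h1 <;>
      linarith [sq_nonneg r, sq_nonneg (ν - a), sq_nonneg (ν + a), sq_nonneg (a : ℝ)]
  have hsum : (S.step N D a).rawLyapunov ≤ S.rawLyapunov -
      2 * (∑ i : Fin 2, ∑ v, (S.len (some i) v : ℝ) *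
        (∑ k, (D.alloc (some i) v k : ℝ) - ∑ k, (D.alloc (some i) k v : ℝ))) +
      2 * a * ∑ i : Fin 2, (S.len (some i) (N.src i) : ℝ) + ∑ _i : Fin 2, ∑ _v : V, e := by
    refine (Finset.sum_le_sum fun i _ => Finset.sum_le_sum fun v _ => hsq i v).trans_eq ?_
    simp only [Finset.sum_add_distrib, Finset.sum_sub_distrib, ← Finset.mul_sum,
      QState.rawLyapunov, Finset.sum_ite_eq', Finset.mem_univ, if_true]
  have hK₁e : ∑ _i : Fin 2, ∑ _v : V, e = K₁ * (1 + (a : ℝ) ^ 2) := by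
    simp only [hK₁, he, Finset.sum_mul]
  have hKa : K ≤ K * (1 + (a : ℝ) ^ 2) :=
    le_mul_of_one_le_right hK (by linarith [sq_nonneg (a : ℝ)])
  linarith [hsum, hd, hvar, hKa, hK₁e]

/-- Drift of the queries that wait for their processed packet: the computation node serves
`compCap` of them per slot unless almost all of them have a raw packet on its way. -/
lemma QState.Regular.queries_drift {V : Type*} [Fintype V] [DecidableEq V]
    {N : Network V} {V₁ V₂ : Set V} {F : Commodity → Finset ℕ} {S : QState V}
    (hS : S.Regular N V₁ V₂ F) {D : Decision V} (hD : D.IsPiOne N V₁ V₂ S) (a : ℕ) (lam : ℝ) :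
    ((S.step N D a).queries : ℝ) ^ 2 + 2 * (N.compCap - lam) * S.queries ≤
      (S.queries : ℝ) ^ 2 + 3 * (N.compCap : ℝ) ^ 2 * (1 + (a : ℝ) ^ 2) + (a : ℝ) ^ 2 +
        2 * (a - lam) * S.queries +
        2 * N.compCap * ∑ i : Fin 2, ∑ v, (S.len (some i) v : ℝ) := by
  have h1 := hS.queries_step hD a
  have h2 := hS.queries_le
  have h3 := S.pairs_le_queries
  have hb := hD.combine_max
  set b := D.combine.card
  set W := S.queries
  set C := N.compCap
  set T := ∑ i : Fin 2, ∑ v, S.len (some i) v with hT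
  have hTe : ∑ i : Fin 2, ∑ v, (S.len (some i) v : ℝ) = T := by simp [hT]
  rw [hTe]
  have hbC : b ≤ C := hb ▸ min_le_right _ _
  have hserve : W * C ≤ W * b + C * (C + T) := by
    rcases le_total C S.pairs with h | h
    · rw [min_eq_right h] at hb
      rw [hb]; exact Nat.le_add_right _ _
    · have : W ≤ C + T := by omega
      calc W * C ≤ (C + T) * C := Nat.mul_le_mul_right _ this
        _ ≤ _ := by rw [mul_comm]; exact Nat.le_add_left _ _
  have hs : (W : ℝ) * C ≤ W * b + C * (C + T) := by exact_mod_cast hserve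
  have h4 : ((S.step N D a).queries : ℝ) ≤ W + a - b := by
    have : ((S.step N D a).queries : ℝ) + b ≤ W + a := by exact_mod_cast h1
    linarith
  have h5 : ((S.step N D a).queries : ℝ) ^ 2 ≤ ((W : ℝ) + a - b) ^ 2 :=
    pow_le_pow_left₀ (by positivity) h4 2
  have hbC' : (b : ℝ) ^ 2 ≤ (C : ℝ) ^ 2 := by
    exact_mod_cast Nat.pow_le_pow_left hbC 2
  have hab : (0 : ℝ) ≤ a * b := by positivity
  have hCa : (0 : ℝ) ≤ (C : ℝ) ^ 2 * (a : ℝ) ^ 2 := by positivity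
  nlinarith

/-- Drift of the processed packets, up to a multiple of the number of waiting queries. -/
lemma Network.NonOverlapping.exists_proc_drift {V : Type*} [Fintype V] [DecidableEq V]
    {N : Network V} {V₁ V₂ : Set V} (hN : N.NonOverlapping V₁ V₂) (F : Commodity → Finset ℕ)
    {lam x : ℝ} (h0 : 0 ≤ lam) (hlx : lam < x)
    (hx : (fun _ : Commodity => x) ∈ flowRegion N.graph N.linkCap N.origin N.target) :
    ∃ η : ℝ, 0 < η ∧ ∃ K : ℝ, 0 ≤ K ∧ ∀ S : QState V, S.Regular N V₁ V₂ F →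
      ∀ D : Decision V, D.IsPiOne N V₁ V₂ S → ∀ a : ℕ,
      (S.step N D a).procLyapunov N + η * ∑ v, (S.len none v : ℝ) ≤
        S.procLyapunov N + K * (1 + (a : ℝ) ^ 2) + K * S.queries +
          2 * (a - lam) * (S.len none N.compNode + S.queries) := by
  classical
  obtain ⟨L, hL0, hL⟩ := N.exists_abs_sub_target_le
  obtain ⟨η, hη, K, hK, hdrift⟩ := exists_negative_drift
    (B := ∑ _v : V, L) (M := ∑ _v : V, ((F none).card : ℝ))
    h0 hlx (by positivity) (by positivity)
  set r : ℝ := (N.totalCap : ℝ) with hr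
  have hr0 : 0 ≤ r := Nat.cast_nonneg _
  set K₁ : ℝ := ∑ _v : V, (3 * r ^ 2 + 2) with hK₁
  have hK₁0 : 0 ≤ K₁ := by positivity
  refine ⟨η, hη, K₁ + K + 2 * lam + 2 * r, by positivity, fun S hS D hD a => ?_⟩
  set ψ : V → ℝ := fun v => if v ∈ V₂ then (S.len none v : ℝ) else S.len none N.compNode with hψ
  have hψn : ψ N.compNode = S.len none N.compNode := if_pos hN.compNode_mem.2
  have hψd : ψ N.dst = 0 := by
    have : S.len none N.dst = 0 := Finset.card_eq_zero.2 (hS.target_empty none)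
    simp [hψ, hN.dst_mem, this]
  have hle : ∀ v, (S.len none v : ℝ) ≤ ψ v := by
    intro v
    by_cases hv : v ∈ V₂
    · simp [hψ, hv]
    · have : S.len none v = 0 := Finset.card_eq_zero.2 (hS.carried none v hv)
      simp [hψ, hv, this]
  have hvar : N.variation ψ ≤ _ := hD.variation_proc_le hN
  have hflow : 2 * (x * (S.len none N.compNode : ℝ)) ≤ N.variation ψ := by
    have := N.flow_le_variation hx {none} N.dst (by simp [Network.target]) ψ
    rwa [Finset.sum_singleton, hψd, sub_zero, Network.origin, hψn] at this
  have hback : ∑ v, (S.len none v : ℝ) ≤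
      (∑ _v : V, L) * N.variation ψ + ∑ _v : V, ((F none).card : ℝ) := by
    rw [Finset.sum_mul, ← Finset.sum_add_distrib]
    refine Finset.sum_le_sum fun v _ => ?_
    by_cases hv : N.Reaches none v
    · have h1 := (le_abs_self _).trans (hL none v hv ψ)
      simp only [Network.target, hψd, sub_zero] at h1
      have h2 : (0 : ℝ) ≤ (F none).card := by positivity
      linarith [hle v]
    · have h1 : (S.len none v : ℝ) ≤ (F none).card := by
        exact_mod_cast Finset.card_le_card (hS.confined none v hv)
      have h2 := mul_nonneg hL0 (N.variation_nonneg ψ)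
      linarith
  have hd := hdrift _ _ _ (N.variation_nonneg ψ) hflow hback
  set W := S.queries with hW
  have hW0 : (0 : ℝ) ≤ W := Nat.cast_nonneg _
  set e : ℝ := (3 * r ^ 2 + 2) * (1 + (a : ℝ) ^ 2) with he
  have hsq : ∀ v, (((S.step N D a).len none v : ℝ) +
        (if v = N.compNode then (S.step N D a).queries else 0 : ℕ)) ^ 2 ≤
      ((S.len none v : ℝ) + (if v = N.compNode then W else 0 : ℕ)) ^ 2 -
        2 * ((S.len none v : ℝ) *
          (∑ k, (D.alloc none v k : ℝ) - ∑ k, (D.alloc none k v : ℝ))) +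
        2 * a * (if v = N.compNode then (S.len none v : ℝ) else 0) +
        (if v = N.compNode then 2 * (W : ℝ) * (r + a) else 0) +
        e := by
    intro v
    have hlen : (S.step N D a).len none v ≤ (S.len none v - ∑ k, D.alloc none v k) +
        ∑ k, D.alloc none k v + (if v = N.compNode then D.combine.card else 0) :=
      QState.len_step_le hD.permissible a none v
    have hout : ((∑ k, D.alloc none v k : ℕ) : ℝ) ≤ r :=
      Nat.cast_le.2 (hD.permissible.sum_alloc_out_le none v)
    have hin : ((∑ k, D.alloc none k v : ℕ) : ℝ) ≤ r :=
      Nat.cast_le.2 (hD.permissible.sum_alloc_in_le none v)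
    have hq := hS.queries_step hD a
    have h1 := sq_queue_step_le (q := S.len none v) (q' := (S.step N D a).len none v)
      (w := if v = N.compNode then W else 0)
      (w' := if v = N.compNode then (S.step N D a).queries else 0)
      (μ := ∑ k, D.alloc none v k)
      (z := ∑ k, D.alloc none k v + (if v = N.compNode then a else 0))
      (by
        split_ifs at hlen ⊢ <;> omega)
    have ha : (0 : ℝ) ≤ a := by positivity
    set μ : ℝ := ((∑ k, D.alloc none v k : ℕ) : ℝ) with hμ
    set ν : ℝ := ((∑ k, D.alloc none k v : ℕ) : ℝ) with hν
    have hμ0 : 0 ≤ μ := Nat.cast_nonneg _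
    have hν0 : 0 ≤ ν := Nat.cast_nonneg _
    have hμ2 : μ ^ 2 ≤ r ^ 2 := pow_le_pow_left₀ hμ0 hout 2
    have hν2 : ν ^ 2 ≤ r ^ 2 := pow_le_pow_left₀ hν0 hin 2
    have hμe : μ = ∑ k, (D.alloc none v k : ℝ) := by simp [hμ]
    have hνe : ν = ∑ k, (D.alloc none k v : ℝ) := by simp [hν]
    rw [← hμe, ← hνe, he]
    have hra : (0 : ℝ) ≤ r ^ 2 * (a : ℝ) ^ 2 := by positivity
    have hWν : (W : ℝ) * ν ≤ W * r := mul_le_mul_of_nonneg_left hin hW0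
    rw [Nat.cast_add (∑ k, D.alloc none k v), ← hν] at h1
    refine h1.trans ?_
    split_ifs <;> push_cast <;>
      linarith [sq_nonneg r, sq_nonneg (ν - a), sq_nonneg (a : ℝ)]
  have hsum : (S.step N D a).procLyapunov N ≤ S.procLyapunov N -
      2 * (∑ v, (S.len none v : ℝ) *
        (∑ k, (D.alloc none v k : ℝ) - ∑ k, (D.alloc none k v : ℝ))) +
      2 * a * S.len none N.compNode + 2 * W * (r + a) + ∑ _v : V, e := by
    refine (Finset.sum_le_sum fun v _ => hsq v).trans_eq ?_
    simp only [Finset.sum_add_distrib, Finset.sum_sub_distrib, ← Finset.mul_sum,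
      QState.procLyapunov, Finset.sum_ite_eq', Finset.mem_univ, if_true, ← hW]
  have hK₁e : ∑ _v : V, e = K₁ * (1 + (a : ℝ) ^ 2) := by
    simp only [hK₁, he, Finset.sum_mul]
  have hKa : K ≤ K * (1 + (a : ℝ) ^ 2) :=
    le_mul_of_one_le_right hK (by linarith [sq_nonneg (a : ℝ)])
  have hrest : 0 ≤ (2 * lam + 2 * r) * (1 + (a : ℝ) ^ 2) := by positivity
  have hrest' : 0 ≤ (K₁ + K) * W := by positivity
  linarith [hsum, hd, hvar, hKa, hK₁e]

/-- A Lyapunov function `Φ` of the whole system. In its drift the weight of the waiting queries is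
chosen large enough to absorb their contribution to the drift of the processed packets, and then
that of the raw packets large enough to absorb theirs to the drift of the queries. -/
lemma Network.NonOverlapping.exists_drift {V : Type*} [Fintype V] [DecidableEq V]
    {N : Network V} {V₁ V₂ : Set V} (hN : N.NonOverlapping V₁ V₂) (F : Commodity → Finset ℕ)
    {lam x : ℝ} (h0 : 0 ≤ lam) (hlx : lam < x) (hxC : x ≤ N.compCap)
    (hx : (fun _ : Commodity => x) ∈ flowRegion N.graph N.linkCap N.origin N.target) :
    ∃ Φ G : QState V → ℝ, ∃ η : ℝ, 0 < η ∧ ∃ K : ℝ, 0 ≤ K ∧ (∀ S, 0 ≤ G S) ∧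
      (∀ S, G S ≤ 2 * Φ S) ∧ ∀ S : QState V, S.Regular N V₁ V₂ F →
      ∀ D : Decision V, D.IsPiOne N V₁ V₂ S → ∀ a : ℕ,
      Φ (S.step N D a) + η * (S.queries + ∑ c, ∑ v, (S.len c v : ℝ)) ≤
        Φ S + K * (1 + (a : ℝ) ^ 2) + (a - lam) * G S := by
  obtain ⟨η₁, hη₁, K₁, hK₁, hraw⟩ := hN.exists_raw_drift F h0 hlx hx
  obtain ⟨η₀, hη₀, K₀, hK₀, hproc⟩ := hN.exists_proc_drift F h0 hlx hx
  set C : ℝ := (N.compCap : ℝ) with hC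
  have hC0 : 0 ≤ C := Nat.cast_nonneg _
  have hClam : 0 < C - lam := by linarith
  set α : ℝ := (K₀ + 1) / (2 * (C - lam)) with hα
  have hα0 : 0 ≤ α := by positivity
  have hαe : α * (2 * (C - lam)) = K₀ + 1 := div_mul_cancel₀ _ (by positivity)
  set β : ℝ := (α * (2 * C) + 1) / η₁ with hβ
  have hβ0 : 0 ≤ β := by positivity
  have hβe : β * η₁ = α * (2 * C) + 1 := div_mul_cancel₀ _ hη₁.ne'
  refine ⟨fun S => S.procLyapunov N + α * (S.queries : ℝ) ^ 2 + β * S.rawLyapunov,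
    fun S => 2 * (S.len none N.compNode + S.queries) + α * (2 * S.queries) +
      β * (2 * ∑ i : Fin 2, (S.len (some i) (N.src i) : ℝ)),
    min η₀ 1, lt_min hη₀ one_pos, K₀ + α * (3 * C ^ 2 + 1) + β * K₁, by positivity,
    fun S => by positivity, fun S => ?_, fun S hS D hD a => ?_⟩
  · have hself : ∀ n : ℕ, (n : ℝ) ≤ (n : ℝ) ^ 2 := fun n => by
      exact_mod_cast Nat.le_self_pow two_ne_zero n
    have h1 : (S.len none N.compNode : ℝ) + S.queries ≤ S.procLyapunov N := by
      have h := Finset.single_le_sum (f := fun v => ((S.len none v : ℝ) +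
        (if v = N.compNode then S.queries else 0 : ℕ)) ^ 2) (fun v _ => by positivity)
        (Finset.mem_univ N.compNode)
      simp only [if_true] at h
      have h2 := hself (S.len none N.compNode + S.queries)
      push_cast at h2
      exact h2.trans h
    have h2 : ∑ i : Fin 2, (S.len (some i) (N.src i) : ℝ) ≤ S.rawLyapunov :=
      Finset.sum_le_sum fun i _ => (hself _).trans
        (Finset.single_le_sum (f := fun v => (S.len (some i) v : ℝ) ^ 2)
          (fun v _ => by positivity) (Finset.mem_univ (N.src i)))
    have h3 := mul_le_mul_of_nonneg_left (hself S.queries) hα0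
    have h4 := mul_le_mul_of_nonneg_left h2 hβ0
    linarith
  · have e1 := mul_le_mul_of_nonneg_left (hraw S hS D hD a) hβ0
    have e2 := mul_le_mul_of_nonneg_left (hS.queries_drift hD a lam) hα0
    have e3 := hproc S hS D hD a
    rw [← hC] at e2
    have hT : ∑ c, ∑ v, (S.len c v : ℝ) =
        ∑ v, (S.len none v : ℝ) + ∑ i : Fin 2, ∑ v, (S.len (some i) v : ℝ) := by
      rw [Fintype.sum_option]
    rw [hT]
    set T₁ := ∑ i : Fin 2, ∑ v, (S.len (some i) v : ℝ) with hT₁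
    set T₀ := ∑ v, (S.len none v : ℝ) with hT₀
    have hT₁0 : 0 ≤ T₁ := by positivity
    have hT₀0 : 0 ≤ T₀ := by positivity
    set W : ℝ := (S.queries : ℝ)
    have hW0 : 0 ≤ W := Nat.cast_nonneg _
    have m0 : min η₀ 1 * T₀ ≤ η₀ * T₀ := mul_le_mul_of_nonneg_right (min_le_left _ _) hT₀0
    have m1 : min η₀ 1 * T₁ ≤ 1 * T₁ := mul_le_mul_of_nonneg_right (min_le_right _ _) hT₁0
    have m2 : min η₀ 1 * W ≤ 1 * W := mul_le_mul_of_nonneg_right (min_le_right _ _) hW0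
    have e2' : α * (2 * (C - lam) * W) = (K₀ + 1) * W := by rw [← hαe]; ring
    have e1' : β * (η₁ * T₁) = (α * (2 * C) + 1) * T₁ := by rw [← hβe]; ring
    have ea : α * (a : ℝ) ^ 2 ≤ α * (1 + (a : ℝ) ^ 2) := by gcongr; linarith
    linarith

/-! ### Measurability and independence along the run -/

lemma run_congr {V : Type*} [Fintype V] [DecidableEq V] (N : Network V) (π : Rule V)
    (S₀ : QState V) {a b : ℕ → ℕ} {t : ℕ} (h : ∀ s < t, a s = b s) :
    run N π S₀ a t = run N π S₀ b t := by
  induction t with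
  | zero => rfl
  | succ t ih =>
    simp only [run, ih fun s hs => h s (by omega), h t (by omega)]

/-- Any function of the state at slot `t` is a function of the arrivals before slot `t`. These take
values in a countable discrete space, so that measurability is automatic. -/
lemma exists_eq_run_comp {V : Type*} [Fintype V] [DecidableEq V] (N : Network V) (π : Rule V)
    (S₀ : QState V) {Ω : Type*} (A : ℕ → Ω → ℕ) (t : ℕ) (f : QState V → ℝ≥0∞) :
    ∃ F : (Finset.range t → ℕ) → ℝ≥0∞, Measurable F ∧
      ∀ ω, f (run N π S₀ (fun s => A s ω) t).2 = F (fun i => A i ω) := by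
  refine ⟨fun b => f (run N π S₀ (fun s => if h : s ∈ Finset.range t then b ⟨s, h⟩ else 0) t).2,
    Measurable.of_discrete, fun ω => ?_⟩
  rw [run_congr N π S₀ (b := fun s => if h : s ∈ Finset.range t then A s ω else 0)]
  intro s hs
  simp [hs]

lemma measurable_run_comp {V : Type*} [Fintype V] [DecidableEq V] (N : Network V) (π : Rule V)
    (S₀ : QState V) {Ω : Type*} [MeasurableSpace Ω] {A : ℕ → Ω → ℕ} (hA : ∀ t, Measurable (A t))
    (t : ℕ) (f : QState V → ℝ≥0∞) :
    Measurable fun ω => f (run N π S₀ (fun s => A s ω) t).2 := by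
  obtain ⟨F, hF, h⟩ := exists_eq_run_comp N π S₀ A t f
  simp_rw [h]
  exact hF.comp (measurable_pi_lambda _ fun i => hA i)

lemma lintegral_arrival_mul_run {V : Type*} [Fintype V] [DecidableEq V] (N : Network V)
    (π : Rule V) (S₀ : QState V) {Ω : Type*} [MeasurableSpace Ω] {μ : Measure Ω} {A : ℕ → Ω → ℕ}
    (hA : ∀ t, Measurable (A t)) (hA_indep : iIndepFun A μ) (t : ℕ) (f : QState V → ℝ≥0∞) :
    ∫⁻ ω, (A t ω : ℝ≥0∞) * f (run N π S₀ (fun s => A s ω) t).2 ∂μ =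
      (∫⁻ ω, (A t ω : ℝ≥0∞) ∂μ) * ∫⁻ ω, f (run N π S₀ (fun s => A s ω) t).2 ∂μ := by
  obtain ⟨F, hF, h⟩ := exists_eq_run_comp N π S₀ A t f
  have hind := hA_indep.indepFun_finset {t} (Finset.range t) (by simp) hA
  have hind' := hind.comp (φ := fun b : ({t} : Finset ℕ) → ℕ =>
    ((b ⟨t, Finset.mem_singleton_self t⟩ : ℕ) : ℝ≥0∞)) (ψ := F) Measurable.of_discrete hF
  simp_rw [h]
  refine lintegral_mul_eq_lintegral_mul_lintegral_of_indepFun ?_ ?_ hind'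
  · exact (Measurable.of_discrete (f := fun n : ℕ => (n : ℝ≥0∞))).comp (hA t)
  · exact hF.comp (measurable_pi_lambda _ fun i => hA i)

/-! ### From drift to stability -/

/-- The Foster–Lyapunov argument: a drift inequality for expectations bounds time averages. -/
lemma limsup_average_lt_top {Φ q : ℕ → ℝ≥0∞} {η K : ℝ≥0∞} (hη : η ≠ 0) (hη' : η ≠ ⊤) (hK : K ≠ ⊤)
    (h0 : Φ 0 ≠ ⊤) (h : ∀ t, Φ (t + 1) + η * q t ≤ Φ t + K) :
    limsup (fun T : ℕ => (∑ t ∈ Finset.Icc 1 T, q t) / (T : ℝ≥0∞)) atTop < ⊤ := by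
  have hsum : ∀ T : ℕ, Φ T + η * ∑ t ∈ Finset.range T, q t ≤ Φ 0 + T * K := by
    intro T
    induction T with
    | zero => simp
    | succ T ih =>
      rw [Finset.sum_range_succ, mul_add]
      calc Φ (T + 1) + (η * ∑ t ∈ Finset.range T, q t + η * q T)
          = (Φ (T + 1) + η * q T) + η * ∑ t ∈ Finset.range T, q t := by ring
        _ ≤ (Φ T + K) + η * ∑ t ∈ Finset.range T, q t :=
          add_le_add_left (h T) _
        _ = (Φ T + η * ∑ t ∈ Finset.range T, q t) + K := by ring
        _ ≤ (Φ 0 + T * K) + K := by gcongr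
        _ = _ := by push_cast; ring
  have hB : η⁻¹ * (Φ 0 + 2 * K) < ⊤ := by
    refine ENNReal.mul_lt_top (ENNReal.inv_lt_top.2 (pos_iff_ne_zero.2 hη)) ?_
    exact ENNReal.add_lt_top.2 ⟨h0.lt_top, ENNReal.mul_lt_top (by simp) hK.lt_top⟩
  refine lt_of_le_of_lt ?_ hB
  refine limsup_le_of_le (by isBoundedDefault) ?_
  filter_upwards [eventually_ge_atTop 1] with T hT
  have hT0 : (T : ℝ≥0∞) ≠ 0 := by simp; omega
  refine ENNReal.div_le_of_le_mul ?_
  have hT1 : (1 : ℝ≥0∞) ≤ T := by exact_mod_cast hT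
  have hsub : ∑ t ∈ Finset.Icc 1 T, q t ≤ ∑ t ∈ Finset.range (T + 1), q t :=
    Finset.sum_le_sum_of_subset fun t ht => by
      rw [Finset.mem_Icc] at ht
      rw [Finset.mem_range]
      omega
  have h1 : η * ∑ t ∈ Finset.Icc 1 T, q t ≤ (Φ 0 + 2 * K) * T :=
    calc η * ∑ t ∈ Finset.Icc 1 T, q t ≤ η * ∑ t ∈ Finset.range (T + 1), q t := by gcongr
      _ ≤ Φ (T + 1) + η * ∑ t ∈ Finset.range (T + 1), q t := le_add_self
      _ ≤ Φ 0 + (T + 1 : ℕ) * K := hsum (T + 1)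
      _ ≤ Φ 0 * T + (2 * T) * K := by
        gcongr
        · exact le_mul_of_one_le_right zero_le hT1
        · push_cast; rw [two_mul]; gcongr
      _ = _ := by ring
  calc ∑ t ∈ Finset.Icc 1 T, q t = η⁻¹ * (η * ∑ t ∈ Finset.Icc 1 T, q t) := by
        rw [← mul_assoc, ENNReal.inv_mul_cancel hη hη', one_mul]
    _ ≤ η⁻¹ * ((Φ 0 + 2 * K) * T) := by gcongr
    _ = _ := by ring

lemma StronglyStable.mono {Ω : Type*} [MeasurableSpace Ω] {μ : Measure Ω} {q : ℕ → Ω → ℕ}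
    {Q : ℕ → Ω → ℝ≥0∞} (hq : ∀ t ω, (q t ω : ℝ≥0∞) ≤ Q t ω)
    (hQ : limsup (fun T : ℕ => (∑ t ∈ Finset.Icc 1 T, ∫⁻ ω, Q t ω ∂μ) / (T : ℝ≥0∞)) atTop < ⊤) :
    StronglyStable μ q := by
  refine lt_of_le_of_lt (limsup_le_limsup (Eventually.of_forall fun T => ?_)) hQ
  exact ENNReal.div_le_div_right
    (Finset.sum_le_sum fun t _ => lintegral_mono fun ω => hq t ω) _

/-- A drift inequality that holds in every state along the run turns into one for expectations,
because the arrivals of a slot are independent of the state. -/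
lemma limsup_average_run_lt_top {V : Type*} [Fintype V] [DecidableEq V] (N : Network V)
    (π : Rule V) (S₀ : QState V) {Ω : Type*} [MeasurableSpace Ω] {μ : Measure Ω}
    [IsProbabilityMeasure μ] {A : ℕ → Ω → ℕ} (hA : ∀ t, Measurable (A t))
    (hA_indep : iIndepFun A μ) (hA_ident : ∀ t, IdentDistrib (A t) (A 0) μ μ)
    (hA_sq : MemLp (fun ω => (A 0 ω : ℝ)) 2 μ) {lam : ℝ} (hlam : ∫ ω, (A 0 ω : ℝ) ∂μ = lam)
    {Φ G Q : QState V → ℝ} {η K : ℝ} (hη : 0 < η) (hK : 0 ≤ K) (hG : ∀ S, 0 ≤ G S)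
    (hGΦ : ∀ S, G S ≤ 2 * Φ S) (hQ : ∀ S, 0 ≤ Q S)
    (hdrift : ∀ a : ℕ → ℕ, ∀ t, Φ (run N π S₀ a (t + 1)).2 + η * Q (run N π S₀ a t).2 ≤
      Φ (run N π S₀ a t).2 + K * (1 + (a t : ℝ) ^ 2) + (a t - lam) * G (run N π S₀ a t).2) :
    limsup (fun T : ℕ => (∑ t ∈ Finset.Icc 1 T,
      ∫⁻ ω, ENNReal.ofReal (Q (run N π S₀ (fun s => A s ω) t).2) ∂μ) / (T : ℝ≥0∞)) atTop < ⊤ := by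
  have hΦ : ∀ S, 0 ≤ Φ S := fun S => by linarith [hG S, hGΦ S]
  have h0 : 0 ≤ lam := hlam ▸ integral_nonneg fun ω => Nat.cast_nonneg _
  have hmean : ∀ t, ∫⁻ ω, (A t ω : ℝ≥0∞) ∂μ = ENNReal.ofReal lam := by
    intro t
    have h1 : ∫⁻ ω, (A t ω : ℝ≥0∞) ∂μ = ∫⁻ ω, (A 0 ω : ℝ≥0∞) ∂μ :=
      ((hA_ident t).comp (u := fun n : ℕ => (n : ℝ≥0∞)) Measurable.of_discrete).lintegral_eq
    rw [h1, ← hlam, ofReal_integral_eq_lintegral_ofReal (hA_sq.integrable (by norm_num))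
      (Eventually.of_forall fun ω => Nat.cast_nonneg _)]
    simp
  have hsq : ∀ t, ∫⁻ ω, ENNReal.ofReal (K * (1 + (A t ω : ℝ) ^ 2)) ∂μ =
      ENNReal.ofReal (∫ ω, K * (1 + (A 0 ω : ℝ) ^ 2) ∂μ) := by
    intro t
    have h1 : ∫⁻ ω, ENNReal.ofReal (K * (1 + (A t ω : ℝ) ^ 2)) ∂μ =
        ∫⁻ ω, ENNReal.ofReal (K * (1 + (A 0 ω : ℝ) ^ 2)) ∂μ :=
      ((hA_ident t).comp (u := fun n : ℕ => ENNReal.ofReal (K * (1 + (n : ℝ) ^ 2)))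
        Measurable.of_discrete).lintegral_eq
    have hint : Integrable (fun ω => K * (1 + (A 0 ω : ℝ) ^ 2)) μ :=
      ((integrable_const 1).add hA_sq.integrable_sq).const_mul K
    rw [h1, ofReal_integral_eq_lintegral_ofReal hint (Eventually.of_forall fun ω => by positivity)]
  set K' : ℝ≥0∞ := ENNReal.ofReal (∫ ω, K * (1 + (A 0 ω : ℝ) ^ 2) ∂μ) with hK'
  set E : (QState V → ℝ) → ℕ → ℝ≥0∞ := fun f t =>
    ∫⁻ ω, ENNReal.ofReal (f (run N π S₀ (fun s => A s ω) t).2) ∂μ with hE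
  have hmeas : ∀ (f : QState V → ℝ) t,
      Measurable fun ω => ENNReal.ofReal (f (run N π S₀ (fun s => A s ω) t).2) := fun f t =>
    measurable_run_comp N π S₀ hA t fun S => ENNReal.ofReal (f S)
  have hK'm : ∀ t, Measurable fun ω => ENNReal.ofReal (K * (1 + (A t ω : ℝ) ^ 2)) := fun t =>
    (Measurable.of_discrete (f := fun n : ℕ => ENNReal.ofReal (K * (1 + (n : ℝ) ^ 2)))).comp (hA t)
  have hAG : ∀ t, Measurable fun ω =>
      (A t ω : ℝ≥0∞) * ENNReal.ofReal (G (run N π S₀ (fun s => A s ω) t).2) := fun t =>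
    ((Measurable.of_discrete (f := fun n : ℕ => (n : ℝ≥0∞))).comp (hA t)).mul (hmeas G t)
  -- The drift inequality with all terms nonnegative, in expectation.
  have hstep : ∀ t, E Φ (t + 1) + ENNReal.ofReal η * E Q t + ENNReal.ofReal lam * E G t ≤
      E Φ t + K' + ENNReal.ofReal lam * E G t := by
    intro t
    have hpt : ∀ ω, ENNReal.ofReal (Φ (run N π S₀ (fun s => A s ω) (t + 1)).2) +
        ENNReal.ofReal η * ENNReal.ofReal (Q (run N π S₀ (fun s => A s ω) t).2) +
        ENNReal.ofReal lam * ENNReal.ofReal (G (run N π S₀ (fun s => A s ω) t).2) ≤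
        ENNReal.ofReal (Φ (run N π S₀ (fun s => A s ω) t).2) +
        ENNReal.ofReal (K * (1 + (A t ω : ℝ) ^ 2)) +
        (A t ω : ℝ≥0∞) * ENNReal.ofReal (G (run N π S₀ (fun s => A s ω) t).2) := by
      intro ω
      have h := hdrift (fun s => A s ω) t
      have hG' := hG (run N π S₀ (fun s => A s ω) t).2
      have hQ' := hQ (run N π S₀ (fun s => A s ω) t).2
      have hΦ' := hΦ (run N π S₀ (fun s => A s ω) t).2
      have hΦ'' := hΦ (run N π S₀ (fun s => A s ω) (t + 1)).2
      rw [← ENNReal.ofReal_natCast, ← ENNReal.ofReal_mul hη.le, ← ENNReal.ofReal_mul h0,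
        ← ENNReal.ofReal_mul (Nat.cast_nonneg _), ← ENNReal.ofReal_add hΦ'' (by positivity),
        ← ENNReal.ofReal_add (by positivity) (by positivity),
        ← ENNReal.ofReal_add hΦ' (by positivity),
        ← ENNReal.ofReal_add (by positivity) (by positivity)]
      refine ENNReal.ofReal_le_ofReal ?_
      linarith
    have hint := lintegral_mono (μ := μ) hpt
    rw [lintegral_add_right _ ((hmeas G t).const_mul _),
      lintegral_add_right _ ((hmeas Q t).const_mul _),
      lintegral_const_mul _ (hmeas Q t), lintegral_const_mul _ (hmeas G t),
      lintegral_add_right _ (hAG t), lintegral_add_right _ (hK'm t), hsq t,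
      lintegral_arrival_mul_run N π S₀ hA hA_indep t (fun S => ENNReal.ofReal (G S)),
      hmean t] at hint
    exact hint
  have hGfin : ∀ t, E Φ t ≠ ⊤ → ENNReal.ofReal lam * E G t ≠ ⊤ := by
    intro t ht
    refine ENNReal.mul_ne_top ENNReal.ofReal_ne_top (ne_top_of_le_ne_top
      (ENNReal.mul_ne_top (ENNReal.ofNat_ne_top (n := 2)) ht) ?_)
    simp only [hE]
    rw [← lintegral_const_mul _ (hmeas Φ t)]
    refine lintegral_mono fun ω => ?_
    rw [← ENNReal.ofReal_ofNat 2, ← ENNReal.ofReal_mul (by norm_num)]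
    exact ENNReal.ofReal_le_ofReal (hGΦ _)
  have hcancel : ∀ t, E Φ t ≠ ⊤ → E Φ (t + 1) + ENNReal.ofReal η * E Q t ≤ E Φ t + K' :=
    fun t ht => (ENNReal.add_le_add_iff_right (hGfin t ht)).1 (hstep t)
  have hΦ0 : E Φ 0 ≠ ⊤ := by simp [hE, run]
  have hfin : ∀ t, E Φ t ≠ ⊤ := by
    intro t
    induction t with
    | zero => exact hΦ0
    | succ t ih =>
      exact ne_top_of_le_ne_top (ENNReal.add_ne_top.2 ⟨ih, ENNReal.ofReal_ne_top⟩)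
        (le_self_add.trans (hcancel t ih))
  exact limsup_average_lt_top (ENNReal.ofReal_pos.2 hη).ne' ENNReal.ofReal_ne_top
    ENNReal.ofReal_ne_top hΦ0 fun t => hcancel t (hfin t)

/-! ### Stability below the maximum rate -/

theorem theorem2 {V : Type*} [Fintype V] [DecidableEq V] (N : Network V) (V₁ V₂ : Set V)
    (hN : N.NonOverlapping V₁ V₂)
    {Ω : Type*} [MeasurableSpace Ω] (μ : Measure Ω) [IsProbabilityMeasure μ]
    (A : ℕ → Ω → ℕ) (hA_meas : ∀ t, Measurable (A t)) (hA_indep : iIndepFun A μ)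
    (hA_ident : ∀ t, IdentDistrib (A t) (A 0) μ μ)
    (hA_sq : MemLp (fun ω => (A 0 ω : ℝ)) 2 μ)
    (lam : ℝ) (hlam : ∫ ω, (A 0 ω : ℝ) ∂μ = lam) (hlt : lam < N.maxQueryRate)
    (π : Rule V) (hπ : ∀ h S, (π h S).IsPiOne N V₁ V₂ S)
    (S₀ : QState V) (hS₀ : S₀.Consistent N V₁ V₂) :
    SystemStable μ (fun t ω => (run N π S₀ (fun s => A s ω) t).2) := by
  have h0 : 0 ≤ lam := hlam ▸ integral_nonneg fun ω => Nat.cast_nonneg _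
  -- The supremum of the empty set is `0`, which would not exceed `lam`.
  have hne : {x : ℝ | (fun _ : Commodity => x) ∈
      flowRegion N.graph N.linkCap N.origin N.target ∧ x ≤ (N.compCap : ℝ)}.Nonempty := by
    by_contra hemp
    rw [Set.not_nonempty_iff_eq_empty] at hemp
    rw [Network.maxQueryRate, hemp, Real.sSup_empty] at hlt
    linarith
  obtain ⟨x, ⟨hx, hxC⟩, hlx⟩ := exists_lt_of_lt_csSup hne hlt
  have horig := N.reaches_origin (h0.trans_lt hlx) hx
  have hreg := hS₀.regular_run hN horig hπ
  obtain ⟨Φ, G, η, hη, K, hK, hG, hGΦ, hdrift⟩ :=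
    hN.exists_drift (fun c => Finset.univ.biUnion (S₀.queue c)) h0 hlx hxC hx
  have hmain := limsup_average_run_lt_top N π S₀ hA_meas hA_indep hA_ident hA_sq hlam
    (Q := fun S => S.queries + ∑ c, ∑ v, (S.len c v : ℝ)) hη hK hG hGΦ
    (fun S => by positivity) (fun a t => hdrift _ (hreg a t) _ (hπ _ _) (a t))
  refine ⟨fun c v => StronglyStable.mono (fun t ω => ?_) hmain,
    fun i => StronglyStable.mono (fun t ω => ?_) hmain⟩ <;>
  rw [← ENNReal.ofReal_natCast] <;> refine ENNReal.ofReal_le_ofReal ?_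
  · set S := (run N π S₀ (fun s => A s ω) t).2
    have h1 : (S.len c v : ℝ) ≤ ∑ v, (S.len c v : ℝ) :=
      Finset.single_le_sum (f := fun v => (S.len c v : ℝ)) (fun _ _ => Nat.cast_nonneg _)
        (Finset.mem_univ v)
    have h2 : ∑ v, (S.len c v : ℝ) ≤ ∑ c, ∑ v, (S.len c v : ℝ) :=
      Finset.single_le_sum (f := fun c => ∑ v, (S.len c v : ℝ)) (fun _ _ => by positivity)
        (Finset.mem_univ c)
    have h3 : (0 : ℝ) ≤ S.queries := Nat.cast_nonneg _
    linarith
  · have h1 : (((run N π S₀ (fun s => A s ω) t).2.comp i).card : ℝ) ≤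
        (run N π S₀ (fun s => A s ω) t).2.queries := by
      exact_mod_cast (hreg (fun s => A s ω) t).comp_card_le i
    refine h1.trans (le_add_of_nonneg_right ?_)
    positivity
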